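/- **Setting.** Let $p\ge 1$ be odd, $m\ge 1$ and $\nu\ge 0$ integers. Consider $u_t+\alpha u_x=0$, $\alpha>0$, on $(-1,1)$ with periodic boundary conditions, on a mesh of $n_x$ points of width $h=2/n_x$ with time step $\delta t>0$. Let $\mathcal S_p^{(\delta t)}\in\mathbb R^{n_x\times n_x}$ be the semi-Lagrangian time-stepping operator: the new value at a mesh point $x_j$ is the value at the departure point $x_j-\alpha\,\delta t$ of the polynomial of degree at most $p$ interpolating the old (periodic) grid values at the $p+1$ mesh points $x_E+qh$, $-\frac{p+1}{2}\le q\le\frac{p-1}{2}$, where $x_E$ is the east neighbour of the departure point (the departure point itself if it is a mesh point). Let $\Phi=\mathcal S_p^{(\delta t)}$ and $\Psi=\mathcal S_p^{(m\delta t)}$ (rediscretization). On semi-infinite temporal grids (fine time indices $n\in\mathbb N_0$; the C-points are the multiples of $m$), let $$\mathcal E=S^{\rm F}\,(I-PA_1^{-1}P^{\top}A_0)\,(S^{\rm CF})^{\nu}S^{\rm F}$$ be the two-grid MGRIT error propagator. Here $(A_0u)_0=u_0$, $(A_0u)_{n}=u_{n}-\Phi u_{n-1}$ for $n\ge1$;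 $A_1$ is the same operator on the coarse grid with $\Psi$ instead of $\Phi$; $P$ is injection from the C-points (zero at the other points); $S^{\rm F}$ keeps C-point values and time-steps with $\Phi$ from each C-point over the following $m-1$ points; $S^{\rm CF}$ is C-relaxation (the value at each C-point $n>0$ is replaced by $\Phi u_{n-1}$, the value at $n=0$ by $0$) followed by $S^{\rm F}$. For a spatial frequency $\omega\in[-\pi,\pi)$, $\omega\in\frac{2\pi}{n_x}\mathbb Z$, and $\theta\in\Theta^{\rm low}=[-\frac{\pi}{m},\frac{\pi}{m})$, let $\widehat{\mathcal E}(\omega,\theta)\in\mathbb C^{m\times m}$ be the Fourier symbol, with entries $$\langle\varrho_a,\mathcal E\varrho_b\rangle,\qquad \varrho_a(x,t)=e^{\mathrm i\omega x/h}\,e^{\mathrm i(\theta+2\pi a/m)t/\delta t},\qquad 0\le a,b<m,$$ where $\langle v,w\rangle=\lim_{N\to\infty}\frac1{N n_x}\sum_{n<N}\sum_{j}\overline{v(x_j,t_n)}\,w(x_j,t_n)$, and let $\rho$ denote the spectral radius. Let $$f_{p+1}(z)=\frac1{(p+1)!}\prod_{q=-\frac{p+1}2}^{\frac{p-1}2}(q+z),\qquad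 \Upsilon_m=(0,1)\setminus\{\varepsilon: m\varepsilon-\lfloor m\varepsilon\rfloor=0\},$$ $$\check\rho_p(\varepsilon)=m\,\frac{f_{p+1}(\varepsilon)}{f_{p+1}(m\varepsilon-\lfloor m\varepsilon\rfloor)}-1\qquad(\varepsilon\in\Upsilon_m).$$ **Theorem (convergence factor lower bound).** (i) Fix the CFL number $c=\alpha\,\delta t/h>0$ and let $\varepsilon=c-\lfloor c\rfloor$ be its fractional part. If $\varepsilon\in\Upsilon_m$, i.e. neither $c$ nor $mc$ is an integer, then for every $n_x\ge1$ the maximum below, over all admissible discrete $\omega$ and all $\theta\in\Theta^{\rm low}$, exists, and $$\max_{(\omega,\theta)}\rho\big(\widehat{\mathcal E}(\omega,\theta)\big)\ \ge\ \check\rho_p(\varepsilon)\,\big(1+\mathcal O(h)\big),\qquad h\to0.$$ The number $\check\rho_p(\varepsilon)$ does not depend on the number $\nu$ of CF-relaxations. The constant in $\mathcal O(h)$ depends only on $p,m,c$; how small $h$ has to be for the $\mathcal O(h)$ estimate to hold may depend on $\nu$ as well. (ii) If $m\ge2$, then $\check\rho_p(\varepsilon)>1$ for every $\varepsilon\in\Upsilon_m\cap\big(\frac{2}{3m},\,1-\frac{2}{3m}\big)$.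 -/

import Mathlib

open Filter Asymptotics

noncomputable section

namespace MGRIT

/-! ### Two-grid MGRIT on semi-infinite temporal grids

Space-time grid functions are maps `u : ℕ → X`, where `u n` is the spatial grid function at the
`n`-th time point. The C-points are the time indices divisible by the coarsening factor `m`. -/

section ErrorPropagation

variable {X : Type*} [AddCommGroup X] [Module ℂ X]

/-- The block lower bidiagonal one-step operator with identity on the diagonal and `-Φ` on the
first subdiagonal. It is the fine-grid operator `A₀` for the fine time-stepping operator, and the
coarse-grid operator `A₁` for the coarse one. -/
def stepOp (Φ : Module.End ℂ X) (u : ℕ → X) : ℕ → X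
  | 0 => u 0
  | n + 1 => u (n + 1) - Φ (u n)

/-- Sequential time stepping: the solution `e` of `stepOp Ψ e = r`. -/
def stepSolve (Ψ : Module.End ℂ X) (r : ℕ → X) : ℕ → X
  | 0 => r 0
  | k + 1 => Ψ (stepSolve Ψ r k) + r (k + 1)

theorem stepOp_stepSolve (Ψ : Module.End ℂ X) (r : ℕ → X) : stepOp Ψ (stepSolve Ψ r) = r := by
  funext n
  cases n with
  | zero => rfl
  | succ k => simp [stepOp, stepSolve]

theorem stepSolve_stepOp (Ψ : Module.End ℂ X) (e : ℕ → X) : stepSolve Ψ (stepOp Ψ e) = e := by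
  funext n
  induction n with
  | zero => rfl
  | succ k ih => simp [stepOp, stepSolve, ih]

/-- Injection interpolation `P` from the C-points into the fine temporal grid. -/
def inject (m : ℕ) (e : ℕ → X) : ℕ → X :=
  fun n => if m ∣ n then e (n / m) else 0

/-- The adjoint of injection: restriction of a fine-grid function to the C-points. -/
def restrictC (m : ℕ) (u : ℕ → X) : ℕ → X :=
  fun k => u (m * k)

/-- Error propagator of F-relaxation: time step from each C-point across the F-points after it. -/
def relaxF (m : ℕ) (Φ : Module.End ℂ X) (u : ℕ → X) : ℕ → X :=
  fun n => (Φ ^ (n % m)) (u (m * (n / m)))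

/-- Error propagator of C-relaxation: time step into each C-point from the point before it; the
error at the initial point, where the solution is prescribed, becomes zero. -/
def relaxC (m : ℕ) (Φ : Module.End ℂ X) (u : ℕ → X) : ℕ → X
  | 0 => 0
  | n + 1 => if m ∣ n + 1 then Φ (u n) else u (n + 1)

/-- Error propagator of CF-relaxation: C-relaxation followed by F-relaxation. -/
def relaxCF (m : ℕ) (Φ : Module.End ℂ X) (u : ℕ → X) : ℕ → X :=
  relaxF m Φ (relaxC m Φ u)

/-- Error propagator `I - P A₁⁻¹ Pᵀ A₀` of the coarse-grid correction. -/
def coarseCorrection (m : ℕ) (Φ Ψ : Module.End ℂ X) (u : ℕ → X) : ℕ → X :=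
  u - inject m (stepSolve Ψ (restrictC m (stepOp Φ u)))

/-- The two-grid MGRIT error propagator with pre-relaxation F(CF)^ν and F post-relaxation. -/
def errorPropagator (m ν : ℕ) (Φ Ψ : Module.End ℂ X) (u : ℕ → X) : ℕ → X :=
  relaxF m Φ (coarseCorrection m Φ Ψ ((relaxCF m Φ)^[ν] (relaxF m Φ u)))

end ErrorPropagation

/-! ### Local Fourier analysis

Spatial grid functions live on the periodic mesh `x_j = j h` of `nx` points, `j : ZMod nx`. -/

/-- Spatial frequencies: the `nx` equispaced points `2 π k / nx` of `[-π, π)`. -/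
def spatialFreqs (nx : ℕ) : Set ℝ :=
  {ω | ω ∈ Set.Ico (-Real.pi) Real.pi ∧ ∃ k : ℤ, ω = 2 * Real.pi * k / nx}

/-- The low temporal frequencies `[-π/m, π/m)`. -/
def thetaLow (m : ℕ) : Set ℝ :=
  Set.Ico (-(Real.pi / m)) (Real.pi / m)

/-- The space-time Fourier mode `exp(i ω x / h) exp(i θ t / δt)` at `x = j h`, `t = n δt`. -/
def mode (nx : ℕ) (ω θ : ℝ) : ℕ → ZMod nx → ℂ :=
  fun n j => Complex.exp (Complex.I * ω * (j.val : ℂ)) * Complex.exp (Complex.I * θ * (n : ℂ))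

/-- The scaled Hermitian inner product of space-time grid functions, averaging over the spatial
mesh and, in the limit, over the semi-infinite temporal grid. The modes are orthonormal. -/
def gridInner (nx : ℕ) [NeZero nx] (a b : ℕ → ZMod nx → ℂ) : ℂ :=
  limUnder atTop fun N : ℕ =>
    (1 / (N : ℂ)) * ∑ n ∈ Finset.range N,
      (1 / (nx : ℂ)) * ∑ j : ZMod nx, (starRingEnd ℂ) (a n j) * b n j

/-- The Fourier symbol `V* E V` of the MGRIT error propagator on the space of the `m` harmonics
with spatial frequency `ω` and temporal frequencies `θ + 2 π a / m`, `0 ≤ a < m`. -/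
def errorSymbol (nx : ℕ) [NeZero nx] (m ν : ℕ) (Φ Ψ : Matrix (ZMod nx) (ZMod nx) ℝ) (ω θ : ℝ) :
    Matrix (Fin m) (Fin m) ℂ :=
  Matrix.of fun a b : Fin m =>
    gridInner nx (mode nx ω (θ + 2 * Real.pi * (a : ℕ) / m))
      (errorPropagator m ν
        (Matrix.toLin' (Φ.map ((↑) : ℝ → ℂ))) (Matrix.toLin' (Ψ.map ((↑) : ℝ → ℂ)))
        (mode nx ω (θ + 2 * Real.pi * (b : ℕ) / m)))

/-- The spectral radius of the Fourier symbol (always finite: the symbol is a square matrix). -/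
def lfaSpectralRadius (nx : ℕ) [NeZero nx] (m ν : ℕ) (Φ Ψ : Matrix (ZMod nx) (ZMod nx) ℝ)
    (ω θ : ℝ) : ℝ :=
  (spectralRadius ℂ (errorSymbol nx m ν Φ Ψ ω θ)).toReal

/-! ### Semi-Lagrangian discretization of `u_t + α u_x = 0` on `(-1, 1)`, periodic in space -/

/-- The mesh width `h` of `nx` equispaced points on a periodic interval of length two. -/
def meshWidth (nx : ℕ) : ℝ := 2 / nx

/-- The foot at the old time of the characteristic through the mesh point `x_j = j h`. -/
def departurePoint (nx : ℕ) (α δt : ℝ) (j : ZMod nx) : ℝ :=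
  (j.val : ℝ) * meshWidth nx - α * δt

/-- Index of the mesh point that is the east neighbour of the departure point. -/
def eastIndex (nx : ℕ) (α δt : ℝ) (j : ZMod nx) : ℤ :=
  ⌈departurePoint nx α δt j / meshWidth nx⌉

/-- Indices of the `p + 1` interpolation nodes for odd `p`: the `(p + 1) / 2` mesh points nearest
to the departure point on each of its two sides. -/
def stencil (p nx : ℕ) (α δt : ℝ) (j : ZMod nx) : Finset ℤ :=
  Finset.Icc (eastIndex nx α δt j - ((p : ℤ) + 1) / 2) (eastIndex nx α δt j + ((p : ℤ) - 1) / 2)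

/-- The semi-Lagrangian time-stepping matrix `S_p` with time step `δt`: the new value at `x_j` is
the value at the departure point of the polynomial of degree at most `p` that interpolates the
(periodically extended) old values at the stencil. -/
def semiLagrangian (p nx : ℕ) [NeZero nx] (α δt : ℝ) : Matrix (ZMod nx) (ZMod nx) ℝ :=
  LinearMap.toMatrix' (LinearMap.pi fun j : ZMod nx =>
    Polynomial.leval (departurePoint nx α δt j) ∘ₗ
      Lagrange.interpolate (stencil p nx α δt j) (fun i : ℤ => (i : ℝ) * meshWidth nx) ∘ₗ
      LinearMap.funLeft ℝ ℝ (fun i : ℤ => (i : ZMod nx)))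

theorem semiLagrangian_mulVec (p nx : ℕ) [NeZero nx] (α δt : ℝ) (u : ZMod nx → ℝ) (j : ZMod nx) :
    (semiLagrangian p nx α δt).mulVec u j =
      (Lagrange.interpolate (stencil p nx α δt j) (fun i : ℤ => (i : ℝ) * meshWidth nx)
        (fun i : ℤ => u (i : ZMod nx))).eval (departurePoint nx α δt j) := by
  rw [semiLagrangian, LinearMap.toMatrix'_mulVec]
  rfl

/-- The polynomial `f_{p+1}(z) = (1 / (p+1)!) ∏_{q = -(p+1)/2}^{(p-1)/2} (q + z)` (odd `p`). -/
def fPoly (p : ℕ) (z : ℝ) : ℝ :=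
  (1 / ((p + 1).factorial : ℝ)) *
    ∏ q ∈ Finset.Icc (-(((p : ℤ) + 1) / 2)) (((p : ℤ) - 1) / 2), ((q : ℝ) + z)

/-- The set `Υ_m` of fractional fine-grid CFL numbers for which neither the fine-grid nor the
coarse-grid CFL number is an integer. -/
def Upsilon (m : ℕ) : Set ℝ :=
  Set.Ioo 0 1 \ {ε | (m : ℝ) * ε - ⌊(m : ℝ) * ε⌋ = 0}

/-- The lower bound `ρ̌_p(ε) = m f_{p+1}(ε) / f_{p+1}(m ε - ⌊m ε⌋) - 1`. -/
def rhoCheck (p m : ℕ) (ε : ℝ) : ℝ :=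
  m * (fPoly p ε / fPoly p ((m : ℝ) * ε - ⌊(m : ℝ) * ε⌋)) - 1

end MGRIT

end

/-! A spatial Fourier mode is an eigenvector of both Φ and Ψ, with eigenvalues λ and μ, so on it
MGRIT is a scalar recurrence for the C-point errors. For |μ| < 1, up to a transient decaying like
μ^k, C-point values Z^k with Z = exp(imθ) are multiplied by K = (λ^m − μ) λ^(mν) / (Z^ν (Z − μ)).
The m harmonics coincide at the C-points, so all columns of the symbol are equal and its spectral
radius is |K| (`lfaSpectralRadius_eq`).

The eigenvalue is exp(−iωc) R, where R (`relFactor`) measures the departure from exact advection.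
Seen from the midpoint of the stencil, interpolating an exponential truncates the expansions of
cos(aφ) and sin(aφ) in powers of sin φ (with a factor cos φ for the cosine), φ = ω/2, a = 1 − 2ε:
the omitted coefficients vanish at the nodes, where a is odd. The truncation satisfies E' = iaE − κ
(sin φ)^(2k−1), where 2k = p + 1 and κ (`defect`) is f_{p+1}(ε) up to a factor depending only on k.
Hence |E| < 1 away from φ = 0 when the CFL number is not an integer (`energy_lt_one`), and 1 − R ~ κ
φ^(2k) / (2k) (`norm_relFactor_sub_le`).

Choosing θ = −ωc modulo 2π/m cancels the phases. What remains, |R^m − R'| |R|^(mν) / |1 − R'|, tends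
to |mκ − κ'| / κ' ≥ mκ/κ' − 1 at the lowest nonzero frequency, for every ν, since |R| → 1
(`exists_lower_bound`).

The second assertion compares P(t) = ∏ (j(j+1) + t) at t = ε(1 − ε) and at s = δ(1 − δ), δ the
fractional part of mε. `nodeProd_ratio` bounds P(t)/P(s) below independently of p, which treats all
orders at once. -/

noncomputable section

namespace MGRIT

/-! ### Restriction of MGRIT to an invariant spatial mode -/

section Intertwining

variable {X Y : Type*} [AddCommGroup X] [Module ℂ X] [AddCommGroup Y] [Module ℂ Y]
  {T : Y →ₗ[ℂ] X} {Φ Ψ : Module.End ℂ X} {Φ' Ψ' : Module.End ℂ Y}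

theorem stepOp_map (hΦ : ∀ y, Φ (T y) = T (Φ' y)) (u : ℕ → Y) :
    stepOp Φ (fun n => T (u n)) = fun n => T (stepOp Φ' u n) := by
  funext n
  cases n <;> simp [stepOp, hΦ]

theorem stepSolve_map (hΨ : ∀ y, Ψ (T y) = T (Ψ' y)) (u : ℕ → Y) :
    stepSolve Ψ (fun n => T (u n)) = fun n => T (stepSolve Ψ' u n) := by
  funext n
  induction n with
  | zero => rfl
  | succ k ih => simp [stepSolve, ih, hΨ]

theorem pow_map (hΦ : ∀ y, Φ (T y) = T (Φ' y)) (n : ℕ) (y : Y) :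
    (Φ ^ n) (T y) = T ((Φ' ^ n) y) := by
  induction n generalizing y with
  | zero => simp
  | succ k ih => simp [pow_succ, hΦ, ih]

theorem relaxF_map (m : ℕ) (hΦ : ∀ y, Φ (T y) = T (Φ' y)) (u : ℕ → Y) :
    relaxF m Φ (fun n => T (u n)) = fun n => T (relaxF m Φ' u n) := by
  funext n
  simp [relaxF, pow_map hΦ]

theorem relaxC_map (m : ℕ) (hΦ : ∀ y, Φ (T y) = T (Φ' y)) (u : ℕ → Y) :
    relaxC m Φ (fun n => T (u n)) = fun n => T (relaxC m Φ' u n) := by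
  funext n
  cases n with
  | zero => simp [relaxC]
  | succ n =>
    by_cases h : m ∣ n + 1 <;> simp [relaxC, h, hΦ]

theorem relaxCF_map (m : ℕ) (hΦ : ∀ y, Φ (T y) = T (Φ' y)) (u : ℕ → Y) :
    relaxCF m Φ (fun n => T (u n)) = fun n => T (relaxCF m Φ' u n) := by
  simp only [relaxCF, relaxC_map m hΦ, relaxF_map m hΦ]

theorem coarseCorrection_map (m : ℕ) (hΦ : ∀ y, Φ (T y) = T (Φ' y))
    (hΨ : ∀ y, Ψ (T y) = T (Ψ' y)) (u : ℕ → Y) :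
    coarseCorrection m Φ Ψ (fun n => T (u n)) =
      fun n => T (coarseCorrection m Φ' Ψ' u n) := by
  have h : restrictC m (fun n => T (stepOp Φ' u n)) =
      fun n => T (restrictC m (stepOp Φ' u) n) := rfl
  funext n
  rw [coarseCorrection, stepOp_map hΦ, h, stepSolve_map hΨ]
  by_cases hn : m ∣ n <;> simp [coarseCorrection, inject, hn]

theorem errorPropagator_map (m ν : ℕ) (hΦ : ∀ y, Φ (T y) = T (Φ' y))
    (hΨ : ∀ y, Ψ (T y) = T (Ψ' y)) (u : ℕ → Y) :
    errorPropagator m ν Φ Ψ (fun n => T (u n)) =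
      fun n => T (errorPropagator m ν Φ' Ψ' u n) := by
  have h : ∀ (ν : ℕ) (u : ℕ → Y), (relaxCF m Φ)^[ν] (fun n => T (u n)) =
      fun n => T ((relaxCF m Φ')^[ν] u n) := by
    intro ν
    induction ν with
    | zero => intro u; rfl
    | succ ν ih => intro u; rw [Function.iterate_succ_apply, relaxCF_map m hΦ, ih]; rfl
  rw [errorPropagator, relaxF_map m hΦ, h, coarseCorrection_map m hΦ hΨ, relaxF_map m hΦ]
  rfl

end Intertwining

/-! ### The scalar recurrence for C-point errors -/

section Scalar

/-- Multiplication by a scalar, as a time-stepping operator on `ℂ`. -/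
def scalarStep (l : ℂ) : Module.End ℂ ℂ := l • 1

theorem scalarStep_apply (l x : ℂ) : scalarStep l x = l * x := by simp [scalarStep]

theorem scalarStep_pow_apply (l x : ℂ) (n : ℕ) : (scalarStep l ^ n) x = l ^ n * x := by
  simp [scalarStep, smul_pow]

/-- Extension of C-point values to the fine grid by time stepping with `l`. -/
def extendC (m : ℕ) (l : ℂ) (v : ℕ → ℂ) : ℕ → ℂ := fun n => l ^ (n % m) * v (n / m)

/-- The effect of one CF-relaxation on the C-point values. -/
def shiftC (m : ℕ) (l : ℂ) (v : ℕ → ℂ) : ℕ → ℂ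
  | 0 => 0
  | k + 1 => l ^ m * v k

/-- The C-point errors after coarse-grid correction of the C-point errors `v`. -/
def coarseError (m : ℕ) (l μ : ℂ) (v : ℕ → ℂ) : ℕ → ℂ
  | 0 => 0
  | k + 1 => (l ^ m - μ) * v k + μ * coarseError m l μ v k

variable {m : ℕ}

theorem relaxF_scalar (l : ℂ) (u : ℕ → ℂ) :
    relaxF m (scalarStep l) u = extendC m l (fun k => u (m * k)) := by
  funext n
  simp [relaxF, extendC, scalarStep_pow_apply]

theorem extendC_mul (hm : 1 ≤ m) (l : ℂ) (v : ℕ → ℂ) (k : ℕ) :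
    extendC m l v (m * k) = v k := by
  simp [extendC, Nat.mul_div_cancel_left k hm]

theorem step_extendC_pred (hm : 1 ≤ m) (l : ℂ) (v : ℕ → ℂ) (k : ℕ) :
    l * extendC m l v (m * k + (m - 1)) = l ^ m * v k := by
  have h1 : (m * k + (m - 1)) % m = m - 1 := by
    rw [Nat.mul_add_mod, Nat.mod_eq_of_lt (by omega)]
  have h2 : (m * k + (m - 1)) / m = k := by
    rw [Nat.mul_add_div hm, Nat.div_eq_of_lt (by omega), add_zero]
  rw [extendC, h1, h2, ← mul_assoc, ← pow_succ', Nat.sub_add_cancel hm]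

theorem relaxCF_extendC (hm : 1 ≤ m) (l : ℂ) (v : ℕ → ℂ) :
    relaxCF m (scalarStep l) (extendC m l v) = extendC m l (shiftC m l v) := by
  rw [relaxCF, relaxF_scalar]
  congr 1
  funext k
  cases k with
  | zero => rfl
  | succ k =>
    have h : m * (k + 1) = m * k + (m - 1) + 1 := by rw [mul_add]; omega
    have h' : m ∣ m * k + (m - 1) + 1 := h ▸ dvd_mul_right m (k + 1)
    rw [h]
    simp only [relaxC, h', if_true, scalarStep_apply, shiftC]
    exact step_extendC_pred hm l v k

/-- Only residuals at C-points enter. After F-relaxation these are v (k+1) − l^m v k, so subtracting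
the coarse solve yields the recurrence of `coarseError`. -/
theorem coarseCorrection_extendC (hm : 1 ≤ m) (l μ : ℂ) (v : ℕ → ℂ) (k : ℕ) :
    coarseCorrection m (scalarStep l) (scalarStep μ) (extendC m l v) (m * k) =
      coarseError m l μ v k := by
  have h0 : ∀ k, coarseCorrection m (scalarStep l) (scalarStep μ) (extendC m l v) (m * k) =
      v k - stepSolve (scalarStep μ)
        (restrictC m (stepOp (scalarStep l) (extendC m l v))) k := by
    intro k
    simp [coarseCorrection, inject, extendC_mul hm, Nat.mul_div_cancel_left k hm]
  rw [h0]
  induction k with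
  | zero => simp [stepSolve, restrictC, stepOp, coarseError, extendC]
  | succ k ih =>
    have h : m * (k + 1) = m * k + (m - 1) + 1 := by rw [mul_add]; omega
    have h1 : restrictC m (stepOp (scalarStep l) (extendC m l v)) (k + 1) =
        v (k + 1) - l ^ m * v k := by
      rw [restrictC, h, stepOp, ← h, extendC_mul hm, scalarStep_apply, step_extendC_pred hm]
    rw [stepSolve, h1, coarseError, ← ih, scalarStep_apply]
    ring

theorem errorPropagator_scalar (hm : 1 ≤ m) (ν : ℕ) (l μ : ℂ) (u : ℕ → ℂ) :
    errorPropagator m ν (scalarStep l) (scalarStep μ) u =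
      extendC m l (coarseError m l μ ((shiftC m l)^[ν] (fun k => u (m * k)))) := by
  have h : ∀ (ν : ℕ) (v : ℕ → ℂ), (relaxCF m (scalarStep l))^[ν] (extendC m l v) =
      extendC m l ((shiftC m l)^[ν] v) := by
    intro ν
    induction ν with
    | zero => intro v; rfl
    | succ ν ih =>
      intro v
      rw [Function.iterate_succ_apply, Function.iterate_succ_apply, relaxCF_extendC hm, ih]
  rw [errorPropagator, relaxF_scalar l u, h, relaxF_scalar]
  congr 1
  funext k
  exact coarseCorrection_extendC hm l μ _ k

theorem iterate_shiftC_pow (l Z : ℂ) (ν k : ℕ) :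
    (shiftC m l)^[ν] (fun k => Z ^ k) (k + ν) = l ^ (m * ν) * Z ^ k := by
  induction ν with
  | zero => simp
  | succ ν ih =>
    rw [Function.iterate_succ_apply', ← add_assoc, shiftC, ih, mul_add, pow_add]
    ring

/-- The limiting amplification factor of the C-point errors. -/
def symbolFactor (m ν : ℕ) (l μ Z : ℂ) : ℂ := (l ^ m - μ) * l ^ (m * ν) / (Z ^ ν * (Z - μ))

/-- From index ν on, K Z^k solves the same recurrence, so the difference is a multiple of μ^k. The
alternative l ^ m = μ serves ω = 0, where both eigenvalues are 1 and the coarse correction is exact.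
-/
theorem tendsto_coarseError (ν : ℕ) {l μ Z : ℂ} (hZ : ‖Z‖ = 1) (h : ‖μ‖ < 1 ∨ l ^ m = μ) :
    Tendsto (fun k => coarseError m l μ ((shiftC m l)^[ν] (fun k => Z ^ k)) k -
      symbolFactor m ν l μ Z * Z ^ k) atTop (nhds 0) := by
  have hZ0 : Z ≠ 0 := by rintro rfl; simp at hZ
  rcases h with h | h
  · have hne : Z - μ ≠ 0 := by
      intro h0
      rw [sub_eq_zero] at h0
      rw [← h0, hZ] at h
      exact lt_irrefl _ h
    set d := fun k => coarseError m l μ ((shiftC m l)^[ν] (fun k => Z ^ k)) k -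
      symbolFactor m ν l μ Z * Z ^ k with hd
    have hrec : ∀ k, d (k + ν) = μ ^ k * d ν := by
      intro k
      induction k with
      | zero => simp
      | succ k ih =>
        rw [pow_succ', mul_assoc, ← ih, hd]
        simp only
        rw [add_right_comm, coarseError, iterate_shiftC_pow, symbolFactor]
        field_simp
        ring
    rw [← tendsto_add_atTop_iff_nat ν]
    simp only [hrec]
    simpa using (tendsto_pow_atTop_nhds_zero_of_norm_lt_one h).mul_const (d ν)
  · have h0 : ∀ v k, coarseError m l μ v k = 0 := by
      intro v k
      induction k with
      | zero => rfl
      | succ k ih => simp [coarseError, ih, h]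
    simp [h0, symbolFactor, h]

end Scalar

/-! ### Temporal averages in the limit -/

section Averages

theorem tendsto_average_mod {m : ℕ} (hm : 1 ≤ m) (g : ℕ → ℂ) :
    Tendsto (fun N : ℕ => (1 / (N : ℂ)) * ∑ n ∈ Finset.range N, g (n % m)) atTop
      (nhds ((1 / (m : ℂ)) * ∑ r ∈ Finset.range m, g r)) := by
  have hm0 : (m : ℂ) ≠ 0 := by exact_mod_cast (by omega : m ≠ 0)
  set A := (1 / (m : ℂ)) * ∑ r ∈ Finset.range m, g r with hA
  -- The partial sum minus N·A depends only on N mod m, hence stays bounded.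
  have hper : ∀ q r, ∑ n ∈ Finset.range (m * q + r), g (n % m) - ((m * q + r : ℕ) : ℂ) * A =
      ∑ n ∈ Finset.range r, g (n % m) - (r : ℂ) * A := by
    intro q r
    have h1 : ∀ q, ∑ n ∈ Finset.range (m * q), g (n % m) = ((m * q : ℕ) : ℂ) * A := by
      intro q
      induction q with
      | zero => simp
      | succ q ih =>
        rw [mul_add, mul_one, Finset.sum_range_add, ih]
        have : ∑ x ∈ Finset.range m, g ((m * q + x) % m) = m * A := by
          rw [hA]
          field_simp
          exact Finset.sum_congr rfl fun x hx => by
            rw [Nat.mul_add_mod, Nat.mod_eq_of_lt (Finset.mem_range.1 hx)]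
        rw [this]
        push_cast
        ring
    rw [Finset.sum_range_add, h1]
    simp only [Nat.mul_add_mod]
    push_cast
    ring
  set B := ∑ r ∈ Finset.range m, ‖∑ n ∈ Finset.range r, g (n % m) - (r : ℂ) * A‖ with hB
  have hbd : ∀ N : ℕ, ‖∑ n ∈ Finset.range N, g (n % m) - (N : ℂ) * A‖ ≤ B := by
    intro N
    have h2 := hper (N / m) (N % m)
    rw [Nat.div_add_mod] at h2
    rw [h2]
    exact Finset.single_le_sum (f := fun r => ‖∑ n ∈ Finset.range r, g (n % m) - (r : ℂ) * A‖)
      (fun _ _ => norm_nonneg _) (Finset.mem_range.2 (Nat.mod_lt _ hm))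
  rw [tendsto_iff_norm_sub_tendsto_zero]
  refine squeeze_zero' (Eventually.of_forall fun _ => norm_nonneg _) ?_
    (tendsto_const_div_atTop_nhds_zero_nat B)
  filter_upwards [eventually_ge_atTop 1] with N hN
  have hN0 : (N : ℂ) ≠ 0 := by exact_mod_cast (by omega : N ≠ 0)
  have : (1 / (N : ℂ)) * ∑ n ∈ Finset.range N, g (n % m) - A =
      (∑ n ∈ Finset.range N, g (n % m) - (N : ℂ) * A) / N := by
    field_simp
  rw [this, norm_div, Complex.norm_natCast]
  gcongr
  exact hbd N

/-- Since w^m Z = 1, the product w^n Z^(n/m) depends only on n mod m. The limiting part is thus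
periodic, and the remainder tends to zero and so does its Cesàro mean. -/
theorem tendsto_average_extendC {m : ℕ} (hm : 1 ≤ m) (l K Z w : ℂ) (hw : ‖w‖ = 1)
    (hwZ : w ^ m * Z = 1) (d : ℕ → ℂ)
    (hd : Tendsto (fun k => d k - K * Z ^ k) atTop (nhds 0)) :
    Tendsto (fun N : ℕ => (1 / (N : ℂ)) * ∑ n ∈ Finset.range N, w ^ n * extendC m l d n) atTop
      (nhds ((1 / (m : ℂ)) * ∑ r ∈ Finset.range m, w ^ r * l ^ r * K)) := by
  have hsplit : ∀ n, w ^ n * extendC m l d n =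
      w ^ (n % m) * l ^ (n % m) * K +
        w ^ n * l ^ (n % m) * (d (n / m) - K * Z ^ (n / m)) := by
    intro n
    have h1 : w ^ n = w ^ (n % m) * (w ^ m) ^ (n / m) := by
      rw [← pow_mul, ← pow_add, Nat.mod_add_div]
    have h2 : w ^ n * Z ^ (n / m) = w ^ (n % m) := by
      rw [h1, mul_assoc, ← mul_pow, hwZ, one_pow, mul_one]
    rw [← h2, extendC]
    ring
  have hrem : Tendsto (fun n => w ^ n * l ^ (n % m) * (d (n / m) - K * Z ^ (n / m))) atTop
      (nhds 0) := by
    have hdiv : Tendsto (fun n : ℕ => n / m) atTop atTop :=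
      Nat.tendsto_div_const_atTop (by omega)
    have h3 := (hd.comp hdiv).norm.const_mul (∑ r ∈ Finset.range m, ‖l ^ r‖)
    rw [norm_zero, mul_zero] at h3
    rw [tendsto_zero_iff_norm_tendsto_zero]
    refine squeeze_zero (fun _ => norm_nonneg _) (fun n => ?_) h3
    rw [norm_mul, norm_mul, norm_pow w, hw, one_pow, one_mul]
    refine mul_le_mul_of_nonneg_right ?_ (norm_nonneg _)
    exact Finset.single_le_sum (f := fun r => ‖l ^ r‖) (fun _ _ => norm_nonneg _)
      (Finset.mem_range.2 (Nat.mod_lt _ hm))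
  have h4 := (tendsto_average_mod hm (fun r => w ^ r * l ^ r * K)).add hrem.cesaro_smul
  rw [add_zero] at h4
  refine h4.congr fun N => ?_
  simp only [hsplit, Finset.sum_add_distrib, mul_add, one_div, Complex.real_smul]
  push_cast
  rfl

end Averages

/-! ### The symbol and its spectral radius -/

section Symbol

/-- The matrix A has rank at most one and satisfies A² = tA with t = ∑ w a, so its spectrum lies in
{0, t}; if t ≠ 0, then w is an eigenvector for t. -/
theorem spectralRadius_vecMulVec_one {m : ℕ} (hm : 1 ≤ m) (w : Fin m → ℂ) :
    (spectralRadius ℂ (Matrix.of fun a _ : Fin m => w a)).toReal = ‖∑ a, w a‖ := by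
  have : Nonempty (Fin m) := ⟨⟨0, hm⟩⟩
  set A : Matrix (Fin m) (Fin m) ℂ := Matrix.of fun a _ => w a with hA
  set t := ∑ a, w a with ht
  have hsq : A * A = t • A := by
    ext a b
    simp [hA, Matrix.mul_apply, ht, ← Finset.mul_sum, mul_comm]
  have hsub : ∀ z ∈ spectrum ℂ A, z = 0 ∨ z = t := by
    intro z hz
    have h1 := spectrum.subset_polynomial_aeval A (Polynomial.X ^ 2 - Polynomial.C t * Polynomial.X)
      ⟨z, hz, rfl⟩
    have h2 : Polynomial.aeval A (Polynomial.X ^ 2 - Polynomial.C t * Polynomial.X) = 0 := by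
      simp [pow_two, hsq, Algebra.smul_def]
    rw [h2, spectrum.zero_eq] at h1
    have h3 : z * (z - t) = 0 := by
      simp at h1
      linear_combination h1
    rcases mul_eq_zero.1 h3 with h | h
    · exact Or.inl h
    · exact Or.inr (sub_eq_zero.1 h)
  have hmem : t ≠ 0 → t ∈ spectrum ℂ A := by
    intro h0
    rw [spectrum.mem_iff]
    intro hu
    have hv : (algebraMap ℂ (Matrix (Fin m) (Fin m) ℂ) t - A).mulVec w = 0 := by
      ext a
      rw [Algebra.algebraMap_eq_smul_one, Matrix.sub_mulVec, Matrix.smul_mulVec,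
        Matrix.one_mulVec]
      simp [Matrix.mulVec, dotProduct, hA, ← Finset.mul_sum, ← ht, mul_comm]
    have hw : w = 0 := by
      have := Matrix.mulVec_injective_iff_isUnit.2 hu
      exact this (by rw [hv, Matrix.mulVec_zero])
    exact h0 (by simp [ht, hw])
  have : spectralRadius ℂ A = (‖t‖₊ : ENNReal) := by
    apply le_antisymm
    · refine iSup₂_le fun z hz => ?_
      rcases hsub z hz with h | h <;> simp [h]
    · by_cases h0 : t = 0
      · simp [h0]
      · exact le_iSup₂_of_le t (hmem h0) le_rfl
  rw [this]
  simp

/-- The spatial Fourier mode of frequency `ω`. -/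
def spatialMode (nx : ℕ) (ω : ℝ) : ZMod nx → ℂ :=
  fun j => Complex.exp (Complex.I * ω * (j.val : ℂ))

theorem norm_exp_I_mul (x : ℝ) : ‖Complex.exp (Complex.I * x)‖ = 1 := by
  rw [mul_comm, Complex.norm_exp_ofReal_mul_I]

theorem conj_exp_mul_self (x : ℂ) (hx : (starRingEnd ℂ) x = x) :
    (starRingEnd ℂ) (Complex.exp (Complex.I * x)) * Complex.exp (Complex.I * x) = 1 := by
  rw [← Complex.exp_conj, ← Complex.exp_add]
  simp [hx]

theorem sum_conj_spatialMode (nx : ℕ) [NeZero nx] (ω : ℝ) (y z : ℂ) :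
    (1 / (nx : ℂ)) * ∑ j : ZMod nx,
      (starRingEnd ℂ) (spatialMode nx ω j * y) * (z * spatialMode nx ω j) =
      (starRingEnd ℂ) y * z := by
  have h : ∀ j : ZMod nx, (starRingEnd ℂ) (spatialMode nx ω j * y) * (z * spatialMode nx ω j) =
      (starRingEnd ℂ) y * z := by
    intro j
    have h1 := conj_exp_mul_self (ω * (j.val : ℂ))
      (by rw [map_mul, Complex.conj_ofReal, map_natCast])
    rw [← mul_assoc] at h1
    rw [map_mul]
    unfold spatialMode
    linear_combination (starRingEnd ℂ) y * z * h1
  have hn : (nx : ℂ) ≠ 0 := by exact_mod_cast NeZero.ne nx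
  simp only [h, Finset.sum_const, Finset.card_univ, ZMod.card, nsmul_eq_mul]
  field_simp

theorem sum_exp_neg_harmonics {m : ℕ} (hm : 1 ≤ m) (θ : ℝ) (r : ℕ) (hr : r < m) :
    ∑ a : Fin m, ((starRingEnd ℂ)
      (Complex.exp (Complex.I * ((θ + 2 * Real.pi * (a : ℕ) / m : ℝ) : ℂ)))) ^ r =
      if r = 0 then (m : ℂ) else 0 := by
  split_ifs with h0
  · simp [h0]
  have hm0 : (m : ℂ) ≠ 0 := by exact_mod_cast (by omega : m ≠ 0)
  set ζ := Complex.exp (2 * Real.pi * Complex.I / m) with hζ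
  have hprim : IsPrimitiveRoot ζ m := Complex.isPrimitiveRoot_exp m (by omega)
  have hterm : ∀ a : ℕ, ((starRingEnd ℂ)
      (Complex.exp (Complex.I * ((θ + 2 * Real.pi * a / m : ℝ) : ℂ)))) ^ r =
      Complex.exp (-(Complex.I * θ * r)) * ((ζ⁻¹) ^ r) ^ a := by
    intro a
    rw [hζ, ← Complex.exp_conj, map_mul, Complex.conj_I, Complex.conj_ofReal, ← Complex.exp_neg, ← Complex.exp_nat_mul, ← Complex.exp_nat_mul,
      ← Complex.exp_nat_mul, ← Complex.exp_add]
    congr 1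
    push_cast
    ring
  rw [Finset.sum_congr rfl fun (a : Fin m) _ => hterm a, ← Finset.mul_sum,
    Fin.sum_univ_eq_sum_range (fun a => ((ζ⁻¹) ^ r) ^ a)]
  have hne : (ζ⁻¹) ^ r ≠ 1 := fun h => by
    have := (hprim.inv.pow_eq_one_iff_dvd r).1 h
    exact h0 (Nat.eq_zero_of_dvd_of_lt this hr)
  have hg := mul_geom_sum ((ζ⁻¹) ^ r) m
  rw [← pow_mul, mul_comm r m, pow_mul, hprim.inv.pow_eq_one, one_pow, sub_self] at hg
  rcases mul_eq_zero.1 hg with h | h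
  · exact absurd (sub_eq_zero.1 h) hne
  · rw [h, mul_zero]

theorem lfaSpectralRadius_eq (nx : ℕ) [NeZero nx] {m : ℕ} (hm : 1 ≤ m) (ν : ℕ)
    (Φ Ψ : Matrix (ZMod nx) (ZMod nx) ℝ) (ω θ : ℝ) (l μ : ℂ)
    (hΦ : (Φ.map ((↑) : ℝ → ℂ)).mulVec (spatialMode nx ω) = l • spatialMode nx ω)
    (hΨ : (Ψ.map ((↑) : ℝ → ℂ)).mulVec (spatialMode nx ω) = μ • spatialMode nx ω)
    (h : ‖μ‖ < 1 ∨ l ^ m = μ) :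
    lfaSpectralRadius nx m ν Φ Ψ ω θ =
      ‖l ^ m - μ‖ * ‖l‖ ^ (m * ν) / ‖Complex.exp (Complex.I * (m * θ : ℝ)) - μ‖ := by
  have hm0 : (m : ℂ) ≠ 0 := by exact_mod_cast (by omega : m ≠ 0)
  set Z := Complex.exp (Complex.I * (m * θ : ℝ)) with hZ
  have hZn : ‖Z‖ = 1 := norm_exp_I_mul _
  set z : Fin m → ℂ := fun a =>
    Complex.exp (Complex.I * ((θ + 2 * Real.pi * (a : ℕ) / m : ℝ) : ℂ)) with hz
  -- The harmonics alias at the C-points, so the propagated error does not depend on the column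
  -- index b.
  have hzm : ∀ a, z a ^ m = Z := by
    intro a
    rw [hz, hZ]
    simp only
    rw [← Complex.exp_nat_mul, Complex.exp_eq_exp_iff_exists_int]
    refine ⟨(a : ℕ), ?_⟩
    push_cast
    field_simp
  have hmode : ∀ a : Fin m, mode nx ω (θ + 2 * Real.pi * (a : ℕ) / m) =
      fun n => LinearMap.toSpanSingleton ℂ (ZMod nx → ℂ) (spatialMode nx ω) (z a ^ n) := by
    intro a
    funext n j
    rw [LinearMap.toSpanSingleton_apply, Pi.smul_apply, smul_eq_mul, mode, spatialMode, hz]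
    simp only
    rw [← Complex.exp_nat_mul, mul_comm]
    congr 2
    ring
  set T := LinearMap.toSpanSingleton ℂ (ZMod nx → ℂ) (spatialMode nx ω) with hT
  have hΦ' : ∀ y, Matrix.toLin' (Φ.map ((↑) : ℝ → ℂ)) (T y) = T (scalarStep l y) := by
    intro y
    rw [hT, LinearMap.toSpanSingleton_apply, LinearMap.toSpanSingleton_apply, map_smul,
      Matrix.toLin'_apply, hΦ, smul_smul, scalarStep_apply, mul_comm]
  have hΨ' : ∀ y, Matrix.toLin' (Ψ.map ((↑) : ℝ → ℂ)) (T y) = T (scalarStep μ y) := by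
    intro y
    rw [hT, LinearMap.toSpanSingleton_apply, LinearMap.toSpanSingleton_apply, map_smul,
      Matrix.toLin'_apply, hΨ, smul_smul, scalarStep_apply, mul_comm]
  set d := coarseError m l μ ((shiftC m l)^[ν] (fun k => Z ^ k)) with hd
  set K := symbolFactor m ν l μ Z with hK
  have hentry : ∀ a b : Fin m, errorSymbol nx m ν Φ Ψ ω θ a b =
      (1 / (m : ℂ)) * ∑ r ∈ Finset.range m, ((starRingEnd ℂ) (z a)) ^ r * l ^ r * K := by
    intro a b
    have hE : errorPropagator m ν (Matrix.toLin' (Φ.map ((↑) : ℝ → ℂ)))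
        (Matrix.toLin' (Ψ.map ((↑) : ℝ → ℂ)))
        (mode nx ω (θ + 2 * Real.pi * (b : ℕ) / m)) = fun n => T (extendC m l d n) := by
      rw [hmode b, errorPropagator_map m ν hΦ' hΨ', errorPropagator_scalar hm]
      simp only [pow_mul, hzm, hd]
    rw [errorSymbol, Matrix.of_apply, gridInner, hE]
    apply Tendsto.limUnder_eq
    have hlim := tendsto_average_extendC hm l K Z ((starRingEnd ℂ) (z a))
      (by rw [RCLike.norm_conj]; exact norm_exp_I_mul _)
      (by rw [← map_pow, hzm]; exact conj_exp_mul_self _ (Complex.conj_ofReal _))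
      d (tendsto_coarseError ν hZn h)
    refine hlim.congr fun N => ?_
    congr 1
    refine Finset.sum_congr rfl fun n _ => ?_
    rw [← map_pow, ← sum_conj_spatialMode nx ω (z a ^ n) (extendC m l d n)]
    congr 1
    refine Finset.sum_congr rfl fun j _ => ?_
    rw [hmode a]
    simp only [hT, LinearMap.toSpanSingleton_apply, Pi.smul_apply, smul_eq_mul]
    rw [mul_comm (z a ^ n)]
  have hmat : errorSymbol nx m ν Φ Ψ ω θ = Matrix.of fun a _ : Fin m =>
      (1 / (m : ℂ)) * ∑ r ∈ Finset.range m, ((starRingEnd ℂ) (z a)) ^ r * l ^ r * K := by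
    ext a b
    rw [hentry, Matrix.of_apply]
  -- Summing over the harmonics leaves only r = 0, the C-points themselves.
  have hsum : ∑ a : Fin m, (1 / (m : ℂ)) *
      ∑ r ∈ Finset.range m, ((starRingEnd ℂ) (z a)) ^ r * l ^ r * K = K := by
    rw [← Finset.mul_sum, Finset.sum_comm]
    have : ∀ r ∈ Finset.range m, ∑ a : Fin m, ((starRingEnd ℂ) (z a)) ^ r * l ^ r * K =
        (if r = 0 then (m : ℂ) else 0) * l ^ r * K := by
      intro r hr
      rw [← sum_exp_neg_harmonics hm θ r (Finset.mem_range.1 hr), Finset.sum_mul, Finset.sum_mul]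
    rw [Finset.sum_congr rfl this, Finset.sum_eq_single 0]
    · simp only [if_true, pow_zero]
      field_simp
    · intro r _ hr
      simp [hr]
    · intro h0
      exact absurd (Finset.mem_range.2 hm) h0
  rw [lfaSpectralRadius, hmat, spectralRadius_vecMulVec_one hm, hsum, hK, symbolFactor]
  simp [hZn]

end Symbol

/-! ### Truncated multiple-angle expansions and the relative amplification factor -/

/-- Coefficients of the expansion of `sin (a φ) / a` in odd powers of `sin φ`. -/
def sineCoeff (a : ℝ) : ℕ → ℝ
  | 0 => 1
  | j + 1 => sineCoeff a j * ((2 * j + 1) ^ 2 - a ^ 2) / ((2 * j + 2) * (2 * j + 3))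

/-- The partial sum with `k` terms of the expansion of `sin (a φ) / a` in powers of `sin φ`. -/
def sineSum (k : ℕ) (a φ : ℝ) : ℝ :=
  ∑ j ∈ Finset.range k, sineCoeff a j * Real.sin φ ^ (2 * j + 1)

/-- The derivative of `sineSum k a`, a partial sum of the expansion of `cos (a φ)`. -/
def cosineSum (k : ℕ) (a φ : ℝ) : ℝ :=
  ∑ j ∈ Finset.range k, sineCoeff a j * ((2 * j + 1) * Real.sin φ ^ (2 * j) * Real.cos φ)

/-- The defect coefficient in the oscillator equation satisfied by `sineSum k a`. -/
def defect (k : ℕ) (a : ℝ) : ℝ := 2 * k * (2 * k + 1) * sineCoeff a k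

theorem hasDerivAt_sineSum (k : ℕ) (a φ : ℝ) :
    HasDerivAt (sineSum k a) (cosineSum k a φ) φ := by
  unfold sineSum cosineSum
  refine HasDerivAt.fun_sum fun j _ => ?_
  have h := ((Real.hasDerivAt_sin φ).pow (2 * j + 1)).const_mul (sineCoeff a j)
  refine h.congr_deriv ?_
  push_cast
  rfl

/-- The full series solves y'' = −a² y; by the coefficient recursion all powers of sin cancel in the
truncation except the last. For k = 0 the truncated exponent is harmless because the defect
vanishes. -/
theorem hasDerivAt_cosineSum (k : ℕ) (a φ : ℝ) :
    HasDerivAt (cosineSum k a)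
      (-(a ^ 2 * sineSum k a φ) - defect k a * Real.sin φ ^ (2 * k - 1)) φ := by
  induction k with
  | zero =>
    have : cosineSum 0 a = fun _ => 0 := by funext; simp [cosineSum]
    rw [this]
    simpa [sineSum, defect] using hasDerivAt_const φ (0 : ℝ)
  | succ k ih =>
    have h1 : cosineSum (k + 1) a = fun x => cosineSum k a x +
        sineCoeff a k * ((2 * k + 1) * Real.sin x ^ (2 * k) * Real.cos x) := by
      funext x; simp [cosineSum, Finset.sum_range_succ]
    have h2 := ((((Real.hasDerivAt_sin φ).pow (2 * k)).const_mul (2 * (k : ℝ) + 1)).mul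
      (Real.hasDerivAt_cos φ)).const_mul (sineCoeff a k)
    rw [h1]
    refine (ih.add h2).congr_deriv ?_
    have h3 : sineSum (k + 1) a φ = sineSum k a φ + sineCoeff a k * Real.sin φ ^ (2 * k + 1) := by
      simp [sineSum, Finset.sum_range_succ]
    have h4 : defect (k + 1) a = sineCoeff a k * ((2 * k + 1) ^ 2 - a ^ 2) := by
      rw [defect, sineCoeff]
      push_cast
      field_simp
      ring
    have h5 : Real.cos φ * Real.cos φ = 1 - Real.sin φ ^ 2 := by
      rw [← sq, Real.cos_sq']
    have h6 : 2 * (k + 1) - 1 = 2 * k + 1 := by omega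
    rw [h3, h4, h6, defect]
    simp only [Pi.pow_apply]
    rcases Nat.eq_zero_or_pos k with rfl | hk
    · simp
      ring
    · obtain ⟨n, rfl⟩ : ∃ n, k = n + 1 := ⟨k - 1, by omega⟩
      have h7 : 2 * (n + 1) - 1 = 2 * n + 1 := by omega
      have h8 : 2 * (n + 1) = 2 * n + 2 := by ring
      simp only [h8]
      push_cast
      linear_combination
        sineCoeff a (n + 1) * (2 * (n + 1) + 1) * (2 * n + 2) * Real.sin φ ^ (2 * n + 1) * h5

theorem sineCoeff_pos {a : ℝ} (ha : a ^ 2 < 1) (j : ℕ) : 0 < sineCoeff a j := by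
  induction j with
  | zero => simp [sineCoeff]
  | succ j ih =>
    rw [sineCoeff]
    have : (1 : ℝ) ≤ (2 * j + 1) ^ 2 := by
      have : (0 : ℝ) ≤ j := j.cast_nonneg
      nlinarith
    have h : (0 : ℝ) < (2 * j + 1) ^ 2 - a ^ 2 := by linarith
    positivity

theorem defect_pos {k : ℕ} (hk : 1 ≤ k) {a : ℝ} (ha : a ^ 2 < 1) : 0 < defect k a := by
  have := sineCoeff_pos ha k
  have : (0 : ℝ) < k := by exact_mod_cast hk
  unfold defect
  positivity

theorem cosineSum_zero {k : ℕ} (hk : 1 ≤ k) (a : ℝ) : cosineSum k a 0 = 1 := by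
  obtain ⟨n, rfl⟩ : ∃ n, k = n + 1 := ⟨k - 1, by omega⟩
  rw [cosineSum, Finset.sum_range_succ']
  simp [sineCoeff]

theorem sineSum_zero (k : ℕ) (a : ℝ) : sineSum k a 0 = 0 := by
  simp [sineSum]

theorem cosineSum_pos {k : ℕ} (hk : 1 ≤ k) {a : ℝ} (ha : a ^ 2 < 1) {φ : ℝ} (h0 : 0 < φ)
    (h1 : φ < Real.pi / 2) : 0 < cosineSum k a φ := by
  have hs : 0 < Real.sin φ := Real.sin_pos_of_pos_of_lt_pi h0 (by linarith [Real.pi_pos])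
  have hc : 0 < Real.cos φ := Real.cos_pos_of_mem_Ioo ⟨by linarith [Real.pi_pos], h1⟩
  refine Finset.sum_pos (fun j _ => ?_) ⟨0, Finset.mem_range.2 hk⟩
  have := sineCoeff_pos ha j
  positivity

/-- The squared modulus of the amplification factor is below one away from zero frequency. -/
theorem energy_lt_one {k : ℕ} (hk : 1 ≤ k) {a : ℝ} (ha : a ^ 2 < 1) {φ : ℝ} (h0 : φ ≠ 0)
    (h1 : |φ| ≤ Real.pi / 2) : cosineSum k a φ ^ 2 + a ^ 2 * sineSum k a φ ^ 2 < 1 := by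
  set G : ℝ → ℝ := fun x => cosineSum k a x ^ 2 + a ^ 2 * sineSum k a x ^ 2 with hG
  -- The energy of the undamped oscillator is conserved; only the defect contributes, and it
  -- dissipates.
  have hderiv : ∀ x, HasDerivAt G
      (-2 * cosineSum k a x * (defect k a * Real.sin x ^ (2 * k - 1))) x := by
    intro x
    refine (((hasDerivAt_cosineSum k a x).pow 2).add
      (((hasDerivAt_sineSum k a x).pow 2).const_mul (a ^ 2))).congr_deriv ?_
    push_cast
    ring
  have hanti : StrictAntiOn G (Set.Icc 0 (Real.pi / 2)) := by
    refine strictAntiOn_of_deriv_neg (convex_Icc _ _)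
      (fun x _ => (hderiv x).continuousAt.continuousWithinAt) fun x hx => ?_
    rw [interior_Icc] at hx
    rw [(hderiv x).deriv]
    have h3 := cosineSum_pos hk ha hx.1 hx.2
    have h4 := defect_pos hk ha
    have hs : 0 < Real.sin x :=
      Real.sin_pos_of_pos_of_lt_pi hx.1 (by linarith [hx.2, Real.pi_pos])
    have : 0 < cosineSum k a x * (defect k a * Real.sin x ^ (2 * k - 1)) := by positivity
    linarith
  have hG0 : G 0 = 1 := by simp [hG, cosineSum_zero hk, sineSum_zero]
  have heven : G φ = G |φ| := by
    rcases abs_choice φ with h | h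
    · rw [h]
    · rw [h, hG]
      have e1 : cosineSum k a (-φ) = cosineSum k a φ := by
        simp [cosineSum, Even.neg_pow (even_two_mul _)]
      have e2 : sineSum k a (-φ) = -sineSum k a φ := by
        simp [sineSum, Odd.neg_pow ⟨_, rfl⟩]
      simp [e1, e2]
  have hpos : 0 < |φ| := abs_pos.2 h0
  have := hanti ⟨le_rfl, by positivity⟩ ⟨hpos.le, h1⟩ hpos
  rw [hG0, ← heven] at this
  exact this

/-- The complex combination of the partial sums of the cosine and sine expansions; it approximates
`exp (i a φ)`. -/
def expSum (k : ℕ) (a φ : ℝ) : ℂ := cosineSum k a φ + Complex.I * (a * sineSum k a φ)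

theorem hasDerivAt_expSum (k : ℕ) (a φ : ℝ) :
    HasDerivAt (expSum k a)
      (Complex.I * a * expSum k a φ - ((defect k a * Real.sin φ ^ (2 * k - 1) : ℝ) : ℂ)) φ := by
  unfold expSum
  refine ((hasDerivAt_cosineSum k a φ).ofReal_comp.add
    (((hasDerivAt_sineSum k a φ).ofReal_comp.const_mul (a : ℂ)).const_mul Complex.I)).congr_deriv ?_
  push_cast
  linear_combination (-(a : ℂ) ^ 2 * sineSum k a φ) * Complex.I_sq

theorem norm_expSum_lt_one {k : ℕ} (hk : 1 ≤ k) {a : ℝ} (ha : a ^ 2 < 1) {φ : ℝ} (h0 : φ ≠ 0)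
    (h1 : |φ| ≤ Real.pi / 2) : ‖expSum k a φ‖ < 1 := by
  have h := energy_lt_one hk ha h0 h1
  have h2 : ‖expSum k a φ‖ ^ 2 = cosineSum k a φ ^ 2 + a ^ 2 * sineSum k a φ ^ 2 := by
    rw [← Complex.normSq_eq_norm_sq, Complex.normSq_apply]
    simp [expSum]
    ring
  nlinarith [norm_nonneg (expSum k a φ)]

/-- The amplification factor relative to exact advection. -/
def relFactor (k : ℕ) (a φ : ℝ) : ℂ := expSum k a φ * Complex.exp (-(Complex.I * (a * φ)))

/-- The exponential is an integrating factor for the equation of `expSum`, so only the defect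
survives. -/
theorem hasDerivAt_relFactor (k : ℕ) (a φ : ℝ) :
    HasDerivAt (relFactor k a)
      (-((defect k a * Real.sin φ ^ (2 * k - 1) : ℝ) : ℂ) *
        Complex.exp (-(Complex.I * (a * φ)))) φ := by
  have h1 : HasDerivAt (fun x : ℝ => -(Complex.I * ((a : ℂ) * (x : ℂ)))) (-(Complex.I * a)) φ := by
    refine (((((hasDerivAt_id φ).ofReal_comp).const_mul (a : ℂ)).const_mul
      Complex.I).fun_neg).congr_deriv ?_
    simp
  refine ((hasDerivAt_expSum k a φ).mul h1.cexp).congr_deriv ?_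
  ring

theorem relFactor_zero {k : ℕ} (hk : 1 ≤ k) (a : ℝ) : relFactor k a 0 = 1 := by
  simp [relFactor, expSum, cosineSum_zero hk, sineSum_zero]

theorem expSum_eq_relFactor (k : ℕ) (a φ : ℝ) :
    expSum k a φ = Complex.exp (Complex.I * (a * φ)) * relFactor k a φ := by
  rw [relFactor, mul_comm, mul_assoc, ← Complex.exp_add]
  simp

theorem expSum_of_defect_eq_zero {k : ℕ} (hk : 1 ≤ k) {a : ℝ} (h : defect k a = 0) (φ : ℝ) :
    expSum k a φ = Complex.exp (Complex.I * (a * φ)) := by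
  have hc : relFactor k a φ = relFactor k a 0 := by
    refine is_const_of_deriv_eq_zero (fun x => (hasDerivAt_relFactor k a x).differentiableAt)
      (fun x => ?_) φ 0
    rw [(hasDerivAt_relFactor k a x).deriv, h]
    simp
  rw [expSum_eq_relFactor, hc, relFactor_zero hk, mul_one]

theorem sineCoeff_eq_zero {a : ℝ} {i k : ℕ} (hik : i < k) (hi : a ^ 2 = (2 * i + 1) ^ 2) :
    sineCoeff a k = 0 := by
  induction k, hik using Nat.le_induction with
  | base => simp [sineCoeff, hi]
  | succ k _ ih => simp [sineCoeff, ih]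

/-- The derivative of 1 − R is κ (sin x)^n exp(−iax) with n = 2k − 1. Replacing it by κ x^n costs a
relative error O(φ), which is integrated by the mean value inequality. -/
theorem norm_relFactor_sub_le {k : ℕ} (hk : 1 ≤ k) {a : ℝ} (ha : a ^ 2 < 1) {φ : ℝ} (h0 : 0 ≤ φ)
    (h1 : φ ≤ 1) :
    ‖(1 - relFactor k a φ) - ((defect k a * (φ ^ (2 * k) / (2 * k)) : ℝ) : ℂ)‖ ≤
      defect k a * (4 * k ^ 2 * φ) * (φ ^ (2 * k) / (2 * k)) := by
  have hk0 : (0 : ℝ) < k := by exact_mod_cast hk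
  have hκ := defect_pos hk ha
  obtain ⟨n, hn⟩ : ∃ n, 2 * k = n + 1 := ⟨2 * k - 1, by omega⟩
  have hn' : 2 * k - 1 = n := by omega
  have hnr : 2 * (k : ℝ) = n + 1 := by exact_mod_cast hn
  set G : ℝ → ℂ := fun x =>
    (1 - relFactor k a x) - ((defect k a * (x ^ (n + 1) / (n + 1)) : ℝ) : ℂ) with hG
  have hderiv : ∀ x, HasDerivAt G (((defect k a * Real.sin x ^ n : ℝ) : ℂ) *
      Complex.exp (-(Complex.I * (a * x))) - ((defect k a * x ^ n : ℝ) : ℂ)) x := by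
    intro x
    have e1 := (hasDerivAt_relFactor k a x).const_sub 1
    have e2 := (((hasDerivAt_pow (n + 1) x).div_const ((n : ℝ) + 1)).const_mul
      (defect k a)).ofReal_comp
    refine (e1.sub e2).congr_deriv ?_
    rw [hn']
    have : ((n : ℂ) + 1) ≠ 0 := by exact_mod_cast (by omega : n + 1 ≠ 0)
    push_cast
    field_simp
  have hbound : ∀ x ∈ Set.Ico 0 φ, ‖((defect k a * Real.sin x ^ n : ℝ) : ℂ) *
      Complex.exp (-(Complex.I * (a * x))) - ((defect k a * x ^ n : ℝ) : ℂ)‖ ≤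
      defect k a * ((n + 1) * φ ^ (n + 1)) := by
    intro x hx
    have hx0 := hx.1
    have hx1 : x ≤ 1 := hx.2.le.trans h1
    have hs0 : 0 ≤ Real.sin x := Real.sin_nonneg_of_nonneg_of_le_pi hx0 
      (by linarith [Real.pi_gt_three])
    have hsx : Real.sin x ≤ x := Real.sin_le hx0
    have hs1 : x * (1 - x) ≤ Real.sin x := by
      rcases hx0.eq_or_lt with h | h
      · simp [← h]
      · have := Real.sin_gt_sub_cube h
        nlinarith [mul_nonneg hx0 hx0, mul_nonneg hx0 (sub_nonneg.2 hx1)]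
    -- Bernoulli's inequality applied to (1 − x)^n.
    have hpow : x ^ n - n * x ^ (n + 1) ≤ Real.sin x ^ n := by
      have e1 : (x * (1 - x)) ^ n ≤ Real.sin x ^ n :=
        pow_le_pow_left₀ (mul_nonneg hx0 (by linarith)) hs1 n
      have e2 := one_add_mul_le_pow (a := -x) (by linarith) n
      have e3 : x ^ n * (1 + n * -x) ≤ x ^ n * (1 + -x) ^ n :=
        mul_le_mul_of_nonneg_left e2 (by positivity)
      rw [mul_pow] at e1
      calc x ^ n - n * x ^ (n + 1) = x ^ n * (1 + n * -x) := by ring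
        _ ≤ _ := e3
        _ ≤ _ := by simpa [sub_eq_add_neg] using e1
    have hpow' : Real.sin x ^ n ≤ x ^ n := pow_le_pow_left₀ hs0 hsx n
    have hax : |a| ≤ 1 := ((sq_lt_one_iff_abs_lt_one a).1 ha).le
    have hexp : ‖Complex.exp (-(Complex.I * (a * x))) - 1‖ ≤ x := by
      have e := Real.norm_exp_I_mul_ofReal_sub_one_le (x := -(a * x))
      have e' : Complex.I * ((-(a * x) : ℝ) : ℂ) = -(Complex.I * (a * x)) := by push_cast; ring
      rw [e'] at e
      refine e.trans ?_
      rw [norm_neg, Real.norm_eq_abs, abs_mul, abs_of_nonneg hx0]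
      nlinarith
    have hsplit : ((defect k a * Real.sin x ^ n : ℝ) : ℂ) *
        Complex.exp (-(Complex.I * (a * x))) - ((defect k a * x ^ n : ℝ) : ℂ) =
        ((defect k a : ℝ) : ℂ) * (((Real.sin x ^ n : ℝ) : ℂ) *
          (Complex.exp (-(Complex.I * (a * x))) - 1) + ((Real.sin x ^ n - x ^ n : ℝ) : ℂ)) := by
      push_cast
      ring
    rw [hsplit, norm_mul, Complex.norm_real, Real.norm_of_nonneg hκ.le]
    refine mul_le_mul_of_nonneg_left ?_ hκ.le
    have hs : ‖((Real.sin x ^ n : ℝ) : ℂ) * (Complex.exp (-(Complex.I * (a * x))) - 1)‖ ≤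
        x ^ n * x := by
      rw [norm_mul, Complex.norm_real, Real.norm_of_nonneg (by positivity)]
      gcongr
    have hs' : ‖((Real.sin x ^ n - x ^ n : ℝ) : ℂ)‖ ≤ n * x ^ (n + 1) := by
      rw [Complex.norm_real, Real.norm_eq_abs, abs_le]
      constructor
      · linarith
      · have : 0 ≤ (n : ℝ) * x ^ (n + 1) := by positivity
        linarith
    calc _ ≤ x ^ n * x + n * x ^ (n + 1) := (norm_add_le _ _).trans (add_le_add hs hs')
      _ = (n + 1) * x ^ (n + 1) := by ring
      _ ≤ (n + 1) * φ ^ (n + 1) := by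
        have := hx.2.le
        gcongr
  have hmv := norm_image_sub_le_of_norm_deriv_le_segment'
    (fun x _ => (hderiv x).hasDerivWithinAt) hbound φ ⟨h0, le_rfl⟩
  have hG0 : G 0 = 0 := by simp [hG, relFactor_zero hk]
  rw [hG0, sub_zero, sub_zero] at hmv
  rw [hn, hnr]
  refine hmv.trans (le_of_eq ?_)
  have : 4 * (k : ℝ) ^ 2 = (n + 1) ^ 2 := by rw [← hnr]; ring
  rw [this]
  field_simp

/-- With a = 1 − 2ε, the recursion factor (2j+1)² − a² equals 4(j(j+1) + ε(1 − ε)). -/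
theorem defect_eq_prod (k : ℕ) (ε : ℝ) :
    defect k (1 - 2 * ε) * (2 * k).factorial =
      2 * k * 4 ^ k * ∏ j ∈ Finset.range k, ((j : ℝ) * (j + 1) + ε * (1 - ε)) := by
  have h : ∀ k : ℕ, sineCoeff (1 - 2 * ε) k * (2 * k + 1).factorial =
      4 ^ k * ∏ j ∈ Finset.range k, ((j : ℝ) * (j + 1) + ε * (1 - ε)) := by
    intro k
    induction k with
    | zero => simp [sineCoeff]
    | succ k ih =>
      have : (2 * (k + 1) + 1).factorial = (2 * k + 3) * ((2 * k + 2) * (2 * k + 1).factorial) := by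
        rw [show 2 * (k + 1) + 1 = 2 * k + 1 + 1 + 1 by ring, Nat.factorial_succ,
          Nat.factorial_succ (2 * k + 1)]
      rw [Finset.prod_range_succ, this, sineCoeff]
      push_cast
      field_simp
      linear_combination (4 * ((k : ℝ) * (k + 1) + ε * (1 - ε))) * ih
  have hf : ((2 * k + 1).factorial : ℝ) = (2 * k + 1) * (2 * k).factorial := by
    rw [Nat.factorial_succ]
    push_cast
    ring
  have h' := h k
  rw [hf] at h'
  rw [defect]
  linear_combination 2 * (k : ℝ) * h'

/-! ### Polynomial exactness of the semi-Lagrangian operator -/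

section Stencil

variable {p nx : ℕ}

theorem meshWidth_pos (nx : ℕ) [NeZero nx] : 0 < meshWidth nx := by
  have : (0 : ℝ) < nx := by exact_mod_cast NeZero.pos nx
  unfold meshWidth
  positivity

theorem departurePoint_div [NeZero nx] (α δt : ℝ) (j : ZMod nx) :
    departurePoint nx α δt j / meshWidth nx = (j.val : ℝ) - α * δt / meshWidth nx := by
  have := (meshWidth_pos nx).ne'
  unfold departurePoint
  field_simp

theorem eastIndex_eq [NeZero nx] (α δt : ℝ) (j : ZMod nx) :
    eastIndex nx α δt j = (j.val : ℤ) - ⌊α * δt / meshWidth nx⌋ := by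
  rw [eastIndex, departurePoint_div, sub_eq_add_neg, add_comm, ← Int.cast_natCast,
    Int.ceil_add_intCast, Int.ceil_neg]
  ring

theorem mem_stencil {k : ℕ} (hpk : p + 1 = 2 * k) (α δt : ℝ) (j : ZMod nx) (i : ℤ) :
    i ∈ stencil p nx α δt j ↔
      -(k : ℤ) ≤ i - eastIndex nx α δt j ∧ i - eastIndex nx α δt j ≤ k - 1 := by
  rw [stencil, Finset.mem_Icc]
  omega

theorem card_stencil {k : ℕ} (hpk : p + 1 = 2 * k) (α δt : ℝ) (j : ZMod nx) :
    (stencil p nx α δt j).card = p + 1 := by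
  rw [stencil, Int.card_Icc]
  omega

/-- Semi-Lagrangian time stepping is exact on grid functions that agree with a polynomial of
degree at most `p` on the stencil. -/
theorem semiLagrangian_mulVec_of_polynomial [NeZero nx] {k : ℕ} (hpk : p + 1 = 2 * k) (α δt : ℝ)
    (j : ZMod nx) (u : ZMod nx → ℝ) (A : Polynomial ℝ) (hA : A.natDegree ≤ p)
    (hu : ∀ q : ℤ, -(k : ℤ) ≤ q → q ≤ k - 1 →
      u ((eastIndex nx α δt j + q : ℤ) : ZMod nx) = A.eval (q : ℝ)) :
    (semiLagrangian p nx α δt).mulVec u j =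
      A.eval (-Int.fract (α * δt / meshWidth nx)) := by
  have hh := (meshWidth_pos nx).ne'
  set E := eastIndex nx α δt j with hE
  -- A lives in the node offset from the east neighbour; B is the same polynomial in the physical
  -- coordinate. The departure point has offset minus the fractional part of the CFL number.
  set B : Polynomial ℝ := A.comp
    (Polynomial.C (meshWidth nx)⁻¹ * Polynomial.X + Polynomial.C (-(E : ℝ))) with hB
  have hBeval : ∀ x, B.eval x = A.eval (x / meshWidth nx - E) := by
    intro x
    rw [hB, Polynomial.eval_comp]
    congr 1
    simp
    ring
  have hdeg : B.natDegree ≤ p := by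
    rw [hB]
    refine Polynomial.natDegree_comp_le.trans ?_
    calc A.natDegree * _ ≤ A.natDegree * 1 :=
          Nat.mul_le_mul_left _ Polynomial.natDegree_linear_le
      _ ≤ p := by omega
  have hint : B = Lagrange.interpolate (stencil p nx α δt j)
      (fun i : ℤ => (i : ℝ) * meshWidth nx) (fun i : ℤ => u (i : ZMod nx)) := by
    refine Lagrange.eq_interpolate_of_eval_eq _ ?_ ?_ ?_
    · intro a _ b _ hab
      simpa [hh] using hab
    · rw [card_stencil hpk]
      exact lt_of_le_of_lt (Polynomial.degree_le_of_natDegree_le hdeg)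
        (by exact_mod_cast Nat.lt_succ_self p)
    · intro i hi
      rw [mem_stencil hpk, ← hE] at hi
      have := hu (i - E) hi.1 hi.2
      rw [add_sub_cancel] at this
      rw [this, hBeval, mul_div_cancel_right₀ _ hh]
      push_cast
      rfl
  rw [semiLagrangian_mulVec, ← hint, hBeval, departurePoint_div, hE, eastIndex_eq]
  congr 1
  rw [Int.fract]
  push_cast
  ring

end Stencil

/-! ### Eigenvalues of the semi-Lagrangian operator -/

section Eigenvalue

/-- `sineCoeff` as a polynomial in the interpolation point. -/
def sineCoeffPoly : ℕ → Polynomial ℝ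
  | 0 => 1
  | j + 1 => sineCoeffPoly j *
      (Polynomial.C (((2 : ℝ) * j + 1) ^ 2) -
        (1 + Polynomial.C 2 * Polynomial.X) * (1 + Polynomial.C 2 * Polynomial.X)) *
      Polynomial.C (1 / (((2 : ℝ) * j + 2) * (2 * j + 3)))

theorem eval_sineCoeffPoly (j : ℕ) (x : ℝ) :
    (sineCoeffPoly j).eval x = sineCoeff (1 + 2 * x) j := by
  induction j with
  | zero => simp [sineCoeffPoly, sineCoeff]
  | succ j ih =>
    rw [sineCoeffPoly, sineCoeff, Polynomial.eval_mul, Polynomial.eval_mul, ih]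
    simp only [Polynomial.eval_sub, Polynomial.eval_C, Polynomial.eval_mul, Polynomial.eval_add,
      Polynomial.eval_one, Polynomial.eval_X]
    ring

theorem natDegree_sineCoeffPoly_le (j : ℕ) : (sineCoeffPoly j).natDegree ≤ 2 * j := by
  induction j with
  | zero => simp [sineCoeffPoly]
  | succ j ih =>
    rw [sineCoeffPoly]
    have h : (Polynomial.C (((2 : ℝ) * j + 1) ^ 2) -
        (1 + Polynomial.C 2 * Polynomial.X) * (1 + Polynomial.C 2 * Polynomial.X)).natDegree ≤ 2 := by
      compute_degree
    refine (Polynomial.natDegree_mul_C_le _ _).trans ?_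
    refine Polynomial.natDegree_mul_le.trans ?_
    omega

theorem exists_polynomial_cosineSum {k : ℕ} (hk : 1 ≤ k) (φ : ℝ) :
    ∃ A : Polynomial ℝ, A.natDegree ≤ 2 * k - 1 ∧
      ∀ x, A.eval x = cosineSum k (1 + 2 * x) φ := by
  refine ⟨∑ j ∈ Finset.range k, sineCoeffPoly j *
    Polynomial.C ((2 * j + 1) * Real.sin φ ^ (2 * j) * Real.cos φ), ?_, fun x => ?_⟩
  · refine Polynomial.natDegree_sum_le_of_forall_le _ _ fun j hj => ?_
    have := Finset.mem_range.1 hj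
    refine (Polynomial.natDegree_mul_C_le _ _).trans ((natDegree_sineCoeffPoly_le j).trans ?_)
    omega
  · simp only [Polynomial.eval_finsetSum, Polynomial.eval_mul, Polynomial.eval_C,
      eval_sineCoeffPoly, cosineSum]

/-- The sum has degree at most 2k − 2 in x; the factor 1 + 2x uses up the one remaining degree of p
= 2k − 1. -/
theorem exists_polynomial_sineSum {k : ℕ} (hk : 1 ≤ k) (φ : ℝ) :
    ∃ A : Polynomial ℝ, A.natDegree ≤ 2 * k - 1 ∧
      ∀ x, A.eval x = (1 + 2 * x) * sineSum k (1 + 2 * x) φ := by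
  refine ⟨(1 + Polynomial.C 2 * Polynomial.X) * ∑ j ∈ Finset.range k, sineCoeffPoly j *
    Polynomial.C (Real.sin φ ^ (2 * j + 1)), ?_, fun x => ?_⟩
  · have h1 : (1 + Polynomial.C (2 : ℝ) * Polynomial.X).natDegree ≤ 1 := by compute_degree
    have h2 : (∑ j ∈ Finset.range k, sineCoeffPoly j *
        Polynomial.C (Real.sin φ ^ (2 * j + 1))).natDegree ≤ 2 * k - 2 := by
      refine Polynomial.natDegree_sum_le_of_forall_le _ _ fun j hj => ?_
      have := Finset.mem_range.1 hj
      refine (Polynomial.natDegree_mul_C_le _ _).trans ((natDegree_sineCoeffPoly_le j).trans ?_)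
      omega
    refine Polynomial.natDegree_mul_le.trans ?_
    omega
  · simp only [Polynomial.eval_finsetSum, Polynomial.eval_mul, Polynomial.eval_C,
      Polynomial.eval_add, Polynomial.eval_one, Polynomial.eval_X, eval_sineCoeffPoly, sineSum]

/-- At a stencil node a = 1 + 2q is odd with |a| ≤ 2k − 1, so the first omitted coefficient vanishes
and the truncation is exact. -/
theorem expSum_node {k : ℕ} (hk : 1 ≤ k) (φ : ℝ) (q : ℤ) (h1 : -(k : ℤ) ≤ q) (h2 : q ≤ k - 1) :
    cosineSum k (1 + 2 * q) φ = Real.cos ((1 + 2 * q) * φ) ∧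
      (1 + 2 * q) * sineSum k (1 + 2 * q) φ = Real.sin ((1 + 2 * q) * φ) := by
  have hd : defect k (1 + 2 * q) = 0 := by
    have : ∃ i : ℕ, i < k ∧ ((1 : ℝ) + 2 * q) ^ 2 = (2 * i + 1) ^ 2 := by
      rcases le_or_gt 0 q with h | h
      · obtain ⟨i, rfl⟩ := Int.eq_ofNat_of_zero_le h
        refine ⟨i, by omega, ?_⟩
        push_cast
        ring
      · obtain ⟨i, hi⟩ := Int.eq_ofNat_of_zero_le (by omega : 0 ≤ -q - 1)
        refine ⟨i, by omega, ?_⟩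
        have : (q : ℝ) = -i - 1 := by
          have : q = -i - 1 := by omega
          rw [this]
          push_cast
          ring
        rw [this]
        ring
    obtain ⟨i, hik, hi⟩ := this
    rw [defect, sineCoeff_eq_zero hik hi, mul_zero]
  have h := expSum_of_defect_eq_zero hk hd φ
  have e : Complex.I * (((1 + 2 * q : ℝ) : ℂ) * φ) =
      (((1 + 2 * q) * φ : ℝ) : ℂ) * Complex.I := by
    push_cast
    ring
  rw [e] at h
  constructor
  · have := congrArg Complex.re h
    rw [Complex.exp_ofReal_mul_I_re] at this
    rw [← this]
    simp [expSum]
  · have := congrArg Complex.im h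
    rw [Complex.exp_ofReal_mul_I_im] at this
    rw [← this]
    simp [expSum]

/-- Since ω·nx is a multiple of 2π, the mode does not see which representative of the residue class
is taken. -/
theorem spatialMode_intCast {nx : ℕ} [NeZero nx] {ω : ℝ} (hω : ω ∈ spatialFreqs nx) (i : ℤ) :
    spatialMode nx ω (i : ZMod nx) = Complex.exp ((ω * i : ℝ) * Complex.I) := by
  obtain ⟨-, l, hl⟩ := hω
  have hn : (nx : ℂ) ≠ 0 := by exact_mod_cast NeZero.ne nx
  have hval : (((i : ZMod nx).val : ℤ) : ℂ) = i - nx * ((i / nx : ℤ) : ℂ) := by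
    rw [ZMod.val_intCast, Int.emod_def]
    push_cast
    ring
  rw [Int.cast_natCast] at hval
  rw [spatialMode, hval, Complex.exp_eq_exp_iff_exists_int]
  refine ⟨-(l * (i / nx)), ?_⟩
  rw [hl]
  push_cast
  field_simp
  ring

theorem map_ofReal_mulVec {n : Type*} [Fintype n] (M : Matrix n n ℝ) (u : n → ℂ) (j : n) :
    (M.map ((↑) : ℝ → ℂ)).mulVec u j =
      (M.mulVec (fun i => (u i).re) j : ℂ) + (M.mulVec (fun i => (u i).im) j : ℂ) * Complex.I := by
  simp only [Matrix.mulVec, dotProduct, Matrix.map_apply, Complex.ofReal_sum, Finset.sum_mul,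
    ← Finset.sum_add_distrib]
  refine Finset.sum_congr rfl fun i _ => ?_
  conv_lhs => rw [← Complex.re_add_im (u i)]
  push_cast
  ring

/-- Spatial Fourier modes are eigenvectors of the semi-Lagrangian time-stepping matrix. -/
theorem semiLagrangian_mulVec_spatialMode {p nx k : ℕ} [NeZero nx] (hpk : p + 1 = 2 * k)
    (α δt c : ℝ) (hc : α * δt / meshWidth nx = c) {ω : ℝ} (hω : ω ∈ spatialFreqs nx) :
    ((semiLagrangian p nx α δt).map ((↑) : ℝ → ℂ)).mulVec (spatialMode nx ω) =
      (Complex.exp (Complex.I * ((-(ω * c) : ℝ) : ℂ)) *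
        relFactor k (1 - 2 * Int.fract c) (ω / 2)) • spatialMode nx ω := by
  have hk : 1 ≤ k := by omega
  funext j
  set E := eastIndex nx α δt j with hE
  set φ := ω / 2 with hφ
  -- The phase at the midpoint E − 1/2 of the stencil, about which node q has angle (1 + 2q)φ.
  set β : ℝ := ω * E - φ with hβ
  obtain ⟨A, hAd, hA⟩ := exists_polynomial_cosineSum hk φ
  obtain ⟨B, hBd, hB⟩ := exists_polynomial_sineSum hk φ
  have hp : 2 * k - 1 = p := by omega
  rw [hp] at hAd hBd
  have hangle : ∀ q : ℤ, ω * ((E + q : ℤ) : ℝ) = β + (1 + 2 * q) * φ := by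
    intro q
    rw [hβ, hφ]
    push_cast
    ring
  have hdeg : ∀ x y : ℝ, (Polynomial.C x * A + Polynomial.C y * B).natDegree ≤ p := fun x y =>
    (Polynomial.natDegree_add_le _ _).trans (max_le
      ((Polynomial.natDegree_C_mul_le _ _).trans hAd)
      ((Polynomial.natDegree_C_mul_le _ _).trans hBd))
  have heval : ∀ x y z : ℝ, (Polynomial.C x * A + Polynomial.C y * B).eval z =
      x * cosineSum k (1 + 2 * z) φ + y * ((1 + 2 * z) * sineSum k (1 + 2 * z) φ) := by
    intro x y z
    simp [hA, hB]
  have hre := semiLagrangian_mulVec_of_polynomial hpk α δt j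
    (fun i => (spatialMode nx ω i).re) _ (hdeg (Real.cos β) (-Real.sin β)) (by
      intro q h1 h2
      obtain ⟨e1, e2⟩ := expSum_node hk φ q h1 h2
      rw [spatialMode_intCast hω, Complex.exp_ofReal_mul_I_re, ← hE, hangle, heval, e1, e2,
        Real.cos_add]
      ring)
  have him := semiLagrangian_mulVec_of_polynomial hpk α δt j
    (fun i => (spatialMode nx ω i).im) _ (hdeg (Real.sin β) (Real.cos β)) (by
      intro q h1 h2
      obtain ⟨e1, e2⟩ := expSum_node hk φ q h1 h2
      rw [spatialMode_intCast hω, Complex.exp_ofReal_mul_I_im, ← hE, hangle, heval, e1, e2,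
        Real.sin_add])
  rw [map_ofReal_mulVec, hre, him, heval, heval, hc]
  have ha : 1 + 2 * -Int.fract c = 1 - 2 * Int.fract c := by ring
  rw [ha, Pi.smul_apply, smul_eq_mul]
  set a := 1 - 2 * Int.fract c with ha'
  have hexpβ : Complex.exp (Complex.I * β) = Real.cos β + Complex.I * Real.sin β := by
    rw [mul_comm, Complex.exp_mul_I]
    push_cast
    ring
  have hphase : Complex.exp (Complex.I * ((-(ω * c) : ℝ) : ℂ)) * spatialMode nx ω j =
      Complex.exp (Complex.I * β) * Complex.exp (Complex.I * (a * φ)) := by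
    rw [spatialMode, ← Complex.exp_add, ← Complex.exp_add]
    congr 1
    rw [hβ, hE, eastIndex_eq, hc, ha', hφ, Int.fract]
    push_cast
    ring
  have hval : Complex.exp (Complex.I * ((-(ω * c) : ℝ) : ℂ)) * relFactor k a φ *
      spatialMode nx ω j = Complex.exp (Complex.I * β) * expSum k a φ := by
    rw [mul_right_comm, hphase, expSum_eq_relFactor, mul_assoc]
  rw [hval, hexpβ, expSum]
  push_cast
  linear_combination (-Complex.sin (β : ℂ) * a * sineSum k a φ) * Complex.I_sq

end Eigenvalue

/-! ### The interval on which the bound exceeds one -/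

/-- The product `∏_{j<k} (j (j + 1) + t)`, which is `(2k)! |f_{2k}(x)|` for `t = x (1 - x)`. -/
def nodeProd (k : ℕ) (t : ℝ) : ℝ := ∏ j ∈ Finset.range k, ((j : ℝ) * (j + 1) + t)

theorem nodeProd_pos (k : ℕ) {t : ℝ} (ht : 0 < t) : 0 < nodeProd k t :=
  Finset.prod_pos fun j _ => by positivity

theorem nodeProd_mono (k : ℕ) {t s : ℝ} (ht : 0 < t) (hts : t ≤ s) :
    nodeProd k t ≤ nodeProd k s :=
  Finset.prod_le_prod (fun j _ => by positivity) fun j _ => by linarith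

theorem nodeProd_strictMono {k : ℕ} (hk : 1 ≤ k) {t s : ℝ} (ht : 0 < t) (hts : t < s) :
    nodeProd k t < nodeProd k s :=
  Finset.prod_lt_prod_of_nonempty (fun j _ => by positivity) (fun j _ => by linarith)
    ⟨0, Finset.mem_range.2 hk⟩

/-- Passing from s to t costs the factor t/s at j = 0 and at most a relative amount (s − t)/(j(j+1))
for each j ≥ 1. The sum of 1/(j(j+1)) telescopes to less than 1, whence a bound independent of k. -/
theorem nodeProd_ratio {k : ℕ} (hk : 1 ≤ k) {t s : ℝ} (ht : 0 < t) (hts : t ≤ s) :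
    t * (1 - (s - t)) * nodeProd k s ≤ s * nodeProd k t := by
  have hs0 : 0 < s := ht.trans_le hts
  -- Keeping the partial sum 1 − 1/(n+1) instead of its bound 1 lets the induction close.
  have key : ∀ n : ℕ, t * (1 - (s - t) * (1 - 1 / ((n : ℝ) + 1))) * nodeProd (n + 1) s ≤
      s * nodeProd (n + 1) t := by
    intro n
    induction n with
    | zero => simp [nodeProd, mul_comm]
    | succ n ih =>
      have hn : (0 : ℝ) ≤ n := n.cast_nonneg
      rw [nodeProd, Finset.prod_range_succ, ← nodeProd]
      rw [nodeProd.eq_1 (n + 1 + 1) t, Finset.prod_range_succ, ← nodeProd]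
      push_cast
      set q : ℝ := ((n : ℝ) + 1) * (n + 1 + 1) with hq
      have hq0 : 0 < q := by positivity
      have h1 := mul_le_mul_of_nonneg_right ih (by positivity : 0 ≤ q + t)
      have hP := nodeProd_pos (n + 1) hs0
      set P := nodeProd (n + 1) s
      set d := s - t with hd
      have hd0 : 0 ≤ d := by linarith
      set y : ℝ := 1 - 1 / ((n : ℝ) + 1) with hy
      have hy0 : 0 ≤ y := by
        rw [hy, sub_nonneg, div_le_one (by positivity)]
        linarith
      have hy1 : 1 - 1 / ((n : ℝ) + 1 + 1) = y + 1 / q := by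
        rw [hy, hq]
        field_simp
        ring
      rw [hy1]
      have h2 : (1 - d * (y + 1 / q)) * (q + s) ≤ (1 - d * y) * (q + t) := by
        have e : (1 - d * y) * (q + t) - (1 - d * (y + 1 / q)) * (q + s) =
            d * (d * y) + d * (s / q) := by
          have : s = t + d := by rw [hd]; ring
          rw [this]
          field_simp
          ring
        have : 0 ≤ d * (d * y) + d * (s / q) := by positivity
        linarith
      calc t * (1 - d * (y + 1 / q)) * (P * (q + s))
          = t * P * ((1 - d * (y + 1 / q)) * (q + s)) := by ring
        _ ≤ t * P * ((1 - d * y) * (q + t)) := by gcongr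
        _ = t * (1 - d * y) * P * (q + t) := by ring
        _ ≤ s * nodeProd (n + 1) t * (q + t) := h1
        _ = _ := by ring
  obtain ⟨n, rfl⟩ : ∃ n, k = n + 1 := ⟨k - 1, by omega⟩
  refine le_trans ?_ (key n)
  have hn : (0 : ℝ) < 1 / ((n : ℝ) + 1) := by positivity
  have := nodeProd_pos (n + 1) hs0
  gcongr t * (1 - ?_) * _
  exact mul_le_of_le_one_right (by linarith) (by linarith)

/-- The factors q = j and q = −j − 1 pair up: (x + j)(x − j − 1) = −(j(j+1) + x(1 − x)). -/
theorem fPoly_eq {p k : ℕ} (hpk : p + 1 = 2 * k) (x : ℝ) :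
    fPoly p x = (-1) ^ k * nodeProd k (x * (1 - x)) / (2 * k).factorial := by
  have h1 : ((p : ℤ) + 1) / 2 = k := by omega
  have h2 : ((p : ℤ) - 1) / 2 = k - 1 := by omega
  have key : ∀ k : ℕ, ∏ q ∈ Finset.Icc (-(k : ℤ)) ((k : ℤ) - 1), ((q : ℝ) + x) =
      (-1) ^ k * nodeProd k (x * (1 - x)) := by
    intro k
    induction k with
    | zero => simp [nodeProd]
    | succ k ih =>
      have e : Finset.Icc (-((k + 1 : ℕ) : ℤ)) (((k + 1 : ℕ) : ℤ) - 1) =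
          insert (-(k : ℤ) - 1) (insert (k : ℤ) (Finset.Icc (-(k : ℤ)) ((k : ℤ) - 1))) := by
        ext q
        simp only [Finset.mem_Icc, Finset.mem_insert]
        omega
      rw [e, Finset.prod_insert, Finset.prod_insert, ih, nodeProd, nodeProd,
        Finset.prod_range_succ]
      · push_cast
        ring
      · simp
      · simp only [Finset.mem_Icc, Finset.mem_insert]
        omega
  rw [fPoly, h1, h2, key, hpk]
  ring

theorem rhoCheck_eq {p k : ℕ} (hpk : p + 1 = 2 * k) (m : ℕ) (ε : ℝ) :
    rhoCheck p m ε = m * (nodeProd k (ε * (1 - ε)) /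
      nodeProd k (Int.fract (m * ε) * (1 - Int.fract (m * ε)))) - 1 := by
  have hf : ((2 * k).factorial : ℝ) ≠ 0 := by exact_mod_cast Nat.factorial_ne_zero _
  have h1 : ((-1 : ℝ)) ^ k ≠ 0 := pow_ne_zero _ (by norm_num)
  rw [rhoCheck, fPoly_eq hpk, fPoly_eq hpk, div_div_div_cancel_right₀ hf,
    mul_div_mul_left _ _ h1]
  rfl

theorem two_mul_nodeProd_lt {k : ℕ} (hk : 1 ≤ k) {m : ℕ} (hm : 2 ≤ m) {ε : ℝ}
    (h0 : 2 / (3 * (m : ℝ)) < ε) (h1 : ε ≤ 1 / 2) (hδ : Int.fract (m * ε) ≠ 0) :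
    2 * nodeProd k (Int.fract (m * ε) * (1 - Int.fract (m * ε))) <
      m * nodeProd k (ε * (1 - ε)) := by
  have hmr : (2 : ℝ) ≤ m := by exact_mod_cast hm
  have hm0 : (0 : ℝ) < m := by linarith
  set y := (m : ℝ) * ε with hy
  have hy0 : 2 / 3 < y := by
    rw [div_lt_iff₀ (by positivity)] at h0
    rw [hy]
    linarith
  have hε0 : 0 < ε := lt_trans (by positivity) h0
  set δ := Int.fract y with hδd
  have hδ0 : 0 < δ := lt_of_le_of_ne (Int.fract_nonneg _) (Ne.symm hδ)
  have hδ1 : δ < 1 := Int.fract_lt_one _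
  set t := ε * (1 - ε) with ht
  set s := δ * (1 - δ) with hs
  have ht0 : 0 < t := mul_pos hε0 (by linarith)
  have hs0 : 0 < s := mul_pos hδ0 (by linarith)
  have hs4 : s ≤ 1 / 4 := by rw [hs]; nlinarith [sq_nonneg (δ - 1 / 2)]
  have hPt := nodeProd_pos k ht0
  have hPs := nodeProd_pos k hs0
  -- For s ≤ t monotonicity settles the claim; otherwise `nodeProd_ratio` leaves this inequality
  -- free of k.
  have finish : t ≤ s → 2 * s < m * t * (1 - (s - t)) →
      2 * nodeProd k s < m * nodeProd k t := by
    intro hts h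
    have h2 := nodeProd_ratio hk ht0 hts
    have h3 := mul_lt_mul_of_pos_right h hPs
    have h4 := mul_le_mul_of_nonneg_left h2 hm0.le
    refine lt_of_mul_lt_mul_left ?_ hs0.le
    linarith
  rcases lt_or_ge y 1 with hy1 | hy1
  · have hδy : δ = y := Int.fract_eq_self.2 ⟨by linarith, hy1⟩
    rcases lt_or_ge s t with hst | hts
    · have h2 := nodeProd_strictMono hk hs0 hst
      nlinarith
    -- For m = 2 one has y = 2ε with ε > 1/3, which forces s < t.
    · have hm3 : (3 : ℝ) ≤ m := by
        by_contra hlt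
        have hm2 : m = 2 := by
          have : (m : ℝ) < 3 := by linarith
          have : m < 3 := by exact_mod_cast this
          omega
        have hy2 : y = 2 * ε := by rw [hy, hm2]; norm_num
        rw [hs, ht, hδy, hy2] at hts
        nlinarith
      apply finish hts
      have e1 : (m : ℝ) * t = y * (1 - ε) := by rw [ht, hy]; ring
      have e3 : ε ≤ y / 3 := by rw [hy]; nlinarith
      rw [e1, hs, hδy, ht]
      -- Expanding and using ε ≤ y/3, it suffices that y + 7y²/9 > 1; at y = 2/3 the left side is
      -- 82/81.
      have e4 : 2 * (1 - y) < (1 - ε) * (1 - (y * (1 - y) - ε * (1 - ε))) := by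
        have e5 : ε ^ 2 ≤ (y / 3) ^ 2 := pow_le_pow_left₀ hε0.le e3 2
        have e6 : 0 ≤ y * (1 - y) * ε := by
          have : 0 ≤ 1 - y := by linarith
          positivity
        have e7 : 0 ≤ ε ^ 3 := by positivity
        nlinarith
      have := mul_lt_mul_of_pos_left e4 (by linarith : 0 < y)
      linarith
  · have hy1' : 1 < y := by
      refine lt_of_le_of_ne hy1 fun h => hδ ?_
      rw [hδd, ← h]
      exact Int.fract_one
    have hm3 : (3 : ℝ) ≤ m := by
      by_contra hlt
      have hm2 : m = 2 := by
        have : (m : ℝ) < 3 := by linarith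
        have : m < 3 := by exact_mod_cast this
        omega
      have hy2 : y = 2 * ε := by rw [hy, hm2]; norm_num
      linarith
    rcases le_or_gt s t with hst | hts
    · have h2 := nodeProd_mono k hs0 hst
      nlinarith
    · apply finish hts.le
      -- Together with s ≤ 1/4 and t > 0: 2s ≤ 1/2 = (2/3)(3/4) < mt(1 − (s − t)).
      have e1 : 2 / 3 ≤ (m : ℝ) * t := by
        have : (m : ℝ) * t = y * (1 - ε) := by rw [ht, hy]; ring
        rw [this]
        have hεm : 1 / (m : ℝ) < ε := by
          rw [div_lt_iff₀ hm0]
          linarith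
        have : 3 * ε ≤ y := by rw [hy]; nlinarith
        rcases le_or_gt ε (1 / 3) with h | h
        · nlinarith
        · nlinarith
      have e2 : 0 < 1 - (s - t) := by linarith
      nlinarith

theorem one_lt_rhoCheck {p k : ℕ} (hpk : p + 1 = 2 * k) {m : ℕ} (hm : 2 ≤ m) {ε : ℝ}
    (hε : ε ∈ Upsilon m) (h0 : 2 / (3 * (m : ℝ)) < ε) (h1 : ε < 1 - 2 / (3 * (m : ℝ))) :
    1 < rhoCheck p m ε := by
  have hk : 1 ≤ k := by omega
  have hδ : Int.fract ((m : ℝ) * ε) ≠ 0 := hε.2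
  have hδ0 : 0 < Int.fract ((m : ℝ) * ε) := lt_of_le_of_ne (Int.fract_nonneg _) (Ne.symm hδ)
  have hδ1 := Int.fract_lt_one ((m : ℝ) * ε)
  have main : 2 * nodeProd k (Int.fract (m * ε) * (1 - Int.fract (m * ε))) <
      m * nodeProd k (ε * (1 - ε)) := by
    rcases le_or_gt ε (1 / 2) with h | h
    · exact two_mul_nodeProd_lt hk hm h0 h hδ
    -- Both products are invariant under ε ↦ 1 − ε, which turns δ into 1 − δ.
    · have e : (m : ℝ) * (1 - ε) = -(m * ε) + (m : ℤ) := by push_cast; ring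
      have e' : Int.fract ((m : ℝ) * (1 - ε)) = 1 - Int.fract ((m : ℝ) * ε) := by
        rw [e, Int.fract_add_intCast, Int.fract_neg hδ]
      have := two_mul_nodeProd_lt (k := k) hk hm (ε := 1 - ε) (by linarith) (by linarith)
        (by rw [e']; linarith)
      rw [e'] at this
      convert this using 3 <;> ring
  have hP := nodeProd_pos k (mul_pos hδ0 (by linarith : 0 < 1 - Int.fract ((m : ℝ) * ε)))
  have : 2 < (m : ℝ) * (nodeProd k (ε * (1 - ε)) /
      nodeProd k (Int.fract (m * ε) * (1 - Int.fract (m * ε)))) := by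
    rw [mul_div_assoc', lt_div_iff₀ hP]
    exact main
  rw [rhoCheck_eq hpk]
  linarith

/-! ### Low-frequency asymptotics of the convergence factor -/

section LowFrequency

theorem norm_relFactor (k : ℕ) (a φ : ℝ) : ‖relFactor k a φ‖ = ‖expSum k a φ‖ := by
  have : -(Complex.I * ((a : ℂ) * φ)) = Complex.I * ((-(a * φ) : ℝ) : ℂ) := by
    push_cast
    ring
  rw [relFactor, norm_mul, this, norm_exp_I_mul, mul_one]

theorem norm_one_sub_pow_le (m : ℕ) (x : ℂ) (hx : ‖x‖ ≤ 1) :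
    ‖(1 - x) ^ m - 1 + m * x‖ ≤ 3 ^ m * ‖x‖ ^ 2 := by
  induction m with
  | zero => simp
  | succ m ih =>
    have e : (1 - x) ^ (m + 1) - 1 + ((m + 1 : ℕ) : ℂ) * x =
        (1 - x) * ((1 - x) ^ m - 1 + m * x) + m * x ^ 2 := by
      push_cast
      ring
    have h1 : ‖1 - x‖ ≤ 2 := (norm_sub_le _ _).trans (by rw [norm_one]; linarith)
    have h2 : (m : ℝ) ≤ 3 ^ m := by exact_mod_cast (Nat.lt_pow_self (by norm_num)).le
    rw [e]
    calc _ ≤ ‖1 - x‖ * ‖(1 - x) ^ m - 1 + m * x‖ + m * ‖x‖ ^ 2 := by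
          refine (norm_add_le _ _).trans (le_of_eq ?_)
          rw [norm_mul, norm_mul, Complex.norm_natCast, norm_pow]
      _ ≤ 2 * (3 ^ m * ‖x‖ ^ 2) + 3 ^ m * ‖x‖ ^ 2 := by gcongr
      _ = 3 ^ (m + 1) * ‖x‖ ^ 2 := by ring

/-- The low-frequency lower bound for the two-grid convergence factor, in terms of the relative
amplification factors of the fine- and the coarse-grid operator. -/
theorem exists_lower_bound {k : ℕ} (hk : 1 ≤ k) (m : ℕ) {a b : ℝ} (ha : a ^ 2 < 1)
    (hb : b ^ 2 < 1) {r : ℝ} (hr : r = m * (defect k a / defect k b) - 1) (hr0 : 0 < r) :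
    ∃ C : ℝ, ∀ ν : ℕ, ∃ φ₀ : ℝ, 0 < φ₀ ∧ ∀ φ : ℝ, 0 < φ → φ ≤ φ₀ →
      r * (1 - C * φ) ≤ ‖relFactor k a φ ^ m - relFactor k b φ‖ * ‖relFactor k a φ‖ ^ (m * ν) /
        ‖1 - relFactor k b φ‖ := by
  have hκ := defect_pos hk ha
  have hκ' := defect_pos hk hb
  set κ := defect k a
  set κ' := defect k b
  have hk1 : (1 : ℝ) ≤ k := by exact_mod_cast hk
  set D : ℝ := 4 * (k : ℝ) ^ 2 with hD
  have hD0 : 0 < D := by positivity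
  set C₂ : ℝ := (m * κ + κ') * D + 3 ^ m * (κ * (1 + D)) ^ 2 with hC₂
  have hC₂0 : 0 < C₂ := by positivity
  set B : ℝ := C₂ / (κ' * r) with hB
  have hB0 : 0 < B := by positivity
  refine ⟨B + D + 1, fun ν => ?_⟩
  -- All smallness conditions on φ are collected in φ ≤ 1/L. Only this threshold involves ν; the
  -- constant C does not.
  set L : ℝ := 1 + (B + D + 1) + κ * (1 + D) + (m * ν : ℕ) * (κ * (1 + D)) with hL
  have hnν : (0 : ℝ) ≤ ((m * ν : ℕ) : ℝ) := Nat.cast_nonneg _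
  have hL0 : 0 < L := by positivity
  refine ⟨1 / L, by positivity, fun φ h0 h1 => ?_⟩
  rw [le_div_iff₀ hL0] at h1
  have g1 : 0 ≤ φ * (B + D + 1) := by positivity
  have g2 : 0 ≤ φ * (κ * (1 + D)) := by positivity
  have g3 : 0 ≤ φ * ((m * ν : ℕ) * (κ * (1 + D))) := by positivity
  have hexp : φ + φ * (B + D + 1) + φ * (κ * (1 + D)) + φ * ((m * ν : ℕ) * (κ * (1 + D))) ≤ 1 := by
    rw [hL] at h1
    linarith
  have hφ1 : φ ≤ 1 := by linarith
  have c1 : φ * (B + D + 1) ≤ 1 := by linarith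
  have c2 : φ * (κ * (1 + D)) ≤ 1 := by linarith
  have c3 : φ * ((m * ν : ℕ) * (κ * (1 + D))) ≤ 1 := by linarith
  set τ : ℝ := φ ^ (2 * k) / (2 * k) with hτ
  have hτ0 : 0 < τ := by positivity
  have hτ2 : τ ≤ φ ^ 2 := by
    rw [hτ, div_le_iff₀ (by positivity)]
    have e1 : φ ^ (2 * k) ≤ φ ^ 2 := pow_le_pow_of_le_one h0.le hφ1 (by omega)
    have e2 : φ ^ 2 * 1 ≤ φ ^ 2 * (2 * k) := by gcongr; linarith
    linarith
  have hτ1 : τ ≤ φ := hτ2.trans (by nlinarith)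
  have hx' := norm_relFactor_sub_le hk ha h0.le hφ1
  have hy' := norm_relFactor_sub_le hk hb h0.le hφ1
  set R := relFactor k a φ
  set R' := relFactor k b φ with hR'
  set x := 1 - R with hx
  set y := 1 - R' with hy
  change ‖x - ((κ * τ : ℝ) : ℂ)‖ ≤ κ * (D * φ) * τ at hx'
  change ‖y - ((κ' * τ : ℝ) : ℂ)‖ ≤ κ' * (D * φ) * τ at hy'
  have bound : ∀ (z : ℂ) (w : ℝ), 0 < w → ‖z - ((w * τ : ℝ) : ℂ)‖ ≤ w * (D * φ) * τ →
      ‖z‖ ≤ w * τ * (1 + D * φ) := by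
    intro z w hw h
    have e := norm_le_norm_add_norm_sub' z ((w * τ : ℝ) : ℂ)
    rw [Complex.norm_real, Real.norm_of_nonneg (by positivity)] at e
    linarith
  have hxn := bound x κ hκ hx'
  have hyn := bound y κ' hκ' hy'
  have hxn' : ‖x‖ ≤ κ * (1 + D) * τ := by
    have : κ * τ * (1 + D * φ) ≤ κ * τ * (1 + D * 1) := by gcongr
    linarith
  have hx1 : ‖x‖ ≤ 1 := by
    have : κ * (1 + D) * τ ≤ κ * (1 + D) * φ := by gcongr
    linarith
  -- Strict stability of the coarse operator keeps the denominator from vanishing.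
  have hy0 : 0 < ‖y‖ := by
    rw [norm_pos_iff, hy, sub_ne_zero]
    intro h
    have h2 := norm_expSum_lt_one hk hb h0.ne'
      (by rw [abs_of_pos h0]; linarith [Real.pi_gt_three])
    rw [← norm_relFactor, ← hR', ← h, norm_one] at h2
    exact lt_irrefl _ h2
  have hN : κ' * τ * (r * (1 - B * φ)) ≤ ‖R ^ m - R'‖ := by
    have e1 : R ^ m - R' = (y - m * x) + ((1 - x) ^ m - 1 + m * x) := by
      rw [hx, hy]
      ring
    have e2 : ‖y - m * x‖ - ‖(1 - x) ^ m - 1 + m * x‖ ≤ ‖R ^ m - R'‖ := by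
      rw [e1]
      have := norm_sub_le_norm_add (y - m * x) ((1 - x) ^ m - 1 + m * x)
      linarith
    have e3 : (m * κ - κ') * τ - (m * κ + κ') * D * φ * τ ≤ ‖y - m * x‖ := by
      have e : ((((m * κ - κ') * τ : ℝ)) : ℂ) =
          -(y - m * x) + ((y - ((κ' * τ : ℝ) : ℂ)) - m * (x - ((κ * τ : ℝ) : ℂ))) := by
        push_cast
        ring
      have e' : (m * κ - κ') * τ ≤ ‖((((m * κ - κ') * τ : ℝ)) : ℂ)‖ := by
        rw [Complex.norm_real]
        exact le_abs_self _
      have e'' : ‖((((m * κ - κ') * τ : ℝ)) : ℂ)‖ ≤ ‖y - m * x‖ +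
          (‖y - ((κ' * τ : ℝ) : ℂ)‖ + m * ‖x - ((κ * τ : ℝ) : ℂ)‖) := by
        rw [e]
        refine (norm_add_le _ _).trans ?_
        rw [norm_neg]
        gcongr
        refine (norm_sub_le _ _).trans ?_
        rw [norm_mul, Complex.norm_natCast]
      have : (m : ℝ) * ‖x - ((κ * τ : ℝ) : ℂ)‖ ≤ m * (κ * (D * φ) * τ) := by gcongr
      linarith
    have e4 : ‖(1 - x) ^ m - 1 + m * x‖ ≤ 3 ^ m * (κ * (1 + D)) ^ 2 * φ * τ := by
      refine (norm_one_sub_pow_le m x hx1).trans ?_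
      calc (3 : ℝ) ^ m * ‖x‖ ^ 2 ≤ 3 ^ m * (κ * (1 + D) * τ) ^ 2 := by gcongr
        _ = 3 ^ m * (κ * (1 + D)) ^ 2 * τ * τ := by ring
        _ ≤ _ := by gcongr
    have e5 : κ' * τ * (r * (1 - B * φ)) = (m * κ - κ') * τ - C₂ * φ * τ := by
      have : κ' * r = m * κ - κ' := by
        rw [hr]
        field_simp
      have h' : κ' * r * B = C₂ := by
        rw [hB]
        field_simp
      linear_combination τ * this - τ * φ * h'
    rw [e5, hC₂]
    linarith
  -- By Bernoulli the loss is at most mν‖x‖ = O(νφ²); one power of φ absorbs ν.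
  have hP : 1 - φ ≤ ‖R‖ ^ (m * ν) := by
    have e1 : 1 - ‖x‖ ≤ ‖R‖ := by
      have := norm_sub_norm_le (1 : ℂ) x
      rwa [norm_one, hx, sub_sub_cancel] at this
    have e2 := one_add_mul_le_pow (a := -‖x‖) (by linarith) (m * ν)
    have e3 : (1 + -‖x‖) ^ (m * ν) ≤ ‖R‖ ^ (m * ν) :=
      pow_le_pow_left₀ (by linarith) (by linarith) _
    have e4 : ((m * ν : ℕ) : ℝ) * ‖x‖ ≤ φ := by
      calc ((m * ν : ℕ) : ℝ) * ‖x‖ ≤ ((m * ν : ℕ) : ℝ) * (κ * (1 + D) * φ ^ 2) := by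
            gcongr
            exact hxn'.trans (by gcongr)
        _ = φ * (φ * ((m * ν : ℕ) * (κ * (1 + D)))) := by ring
        _ ≤ φ * 1 := by gcongr
        _ = φ := mul_one φ
    linarith
  rw [le_div_iff₀ hy0]
  have hC1 : 0 ≤ 1 - (B + D + 1) * φ := by linarith
  have hB1 : 0 ≤ 1 - B * φ := by
    have : 0 ≤ (D + 1) * φ := by positivity
    linarith
  calc r * (1 - (B + D + 1) * φ) * ‖y‖
      ≤ r * (1 - (B + D + 1) * φ) * (κ' * τ * (1 + D * φ)) := by gcongr
    _ = κ' * τ * r * ((1 - (B + D + 1) * φ) * (1 + D * φ)) := by ring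
    -- The first-order terms agree; the difference is the nonnegative quadratic term below.
    _ ≤ κ' * τ * r * ((1 - B * φ) * (1 - φ)) := by
        have : 0 ≤ (B + (B + D + 1) * D) * φ ^ 2 := by positivity
        exact mul_le_mul_of_nonneg_left (by linarith) (by positivity)
    _ = κ' * τ * (r * (1 - B * φ)) * (1 - φ) := by ring
    _ ≤ ‖R ^ m - R'‖ * ‖R‖ ^ (m * ν) := by
        gcongr

end LowFrequency

/-! ### Existence of the maximum and the choice of frequencies -/

section Maximum

/-- The eigenvalue of the semi-Lagrangian operator with CFL number `c` at the frequency `ω`. -/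
def ampFactor (k : ℕ) (c ω : ℝ) : ℂ :=
  Complex.exp (Complex.I * ((-(ω * c) : ℝ) : ℂ)) * relFactor k (1 - 2 * Int.fract c) (ω / 2)

theorem one_sub_two_mul_fract_sq_lt_one {c : ℝ} (hc : Int.fract c ≠ 0) :
    (1 - 2 * Int.fract c) ^ 2 < 1 := by
  have h0 : 0 < Int.fract c := lt_of_le_of_ne (Int.fract_nonneg _) (Ne.symm hc)
  have h1 := Int.fract_lt_one c
  nlinarith

theorem norm_ampFactor_lt_one {k : ℕ} (hk : 1 ≤ k) {c ω : ℝ} (hc : Int.fract c ≠ 0)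
    (hω : ω ∈ Set.Ico (-Real.pi) Real.pi) (h0 : ω ≠ 0) : ‖ampFactor k c ω‖ < 1 := by
  rw [ampFactor, norm_mul, norm_exp_I_mul, one_mul, norm_relFactor]
  refine norm_expSum_lt_one hk (one_sub_two_mul_fract_sq_lt_one hc) (by simpa using h0) ?_
  rw [abs_le]
  constructor <;> linarith [hω.1, hω.2]

theorem ampFactor_zero {k : ℕ} (hk : 1 ≤ k) (c : ℝ) : ampFactor k c 0 = 1 := by
  simp [ampFactor, relFactor_zero hk]

theorem lfaSpectralRadius_semiLagrangian {p nx k m : ℕ} [NeZero nx] (hpk : p + 1 = 2 * k)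
    (hm : 1 ≤ m) (ν : ℕ) {α δt c : ℝ} (hc : α * δt / meshWidth nx = c)
    (hmc : Int.fract (m * c) ≠ 0) {ω : ℝ} (hω : ω ∈ spatialFreqs nx) (θ : ℝ) :
    lfaSpectralRadius nx m ν (semiLagrangian p nx α δt) (semiLagrangian p nx α (m * δt)) ω θ =
      ‖ampFactor k c ω ^ m - ampFactor k (m * c) ω‖ * ‖ampFactor k c ω‖ ^ (m * ν) /
        ‖Complex.exp (Complex.I * (m * θ : ℝ)) - ampFactor k (m * c) ω‖ := by
  have hk : 1 ≤ k := by omega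
  refine lfaSpectralRadius_eq nx hm ν _ _ ω θ _ _
    (semiLagrangian_mulVec_spatialMode hpk α δt c hc hω)
    (semiLagrangian_mulVec_spatialMode hpk α (m * δt) (m * c) (by rw [← hc]; ring) hω) ?_
  by_cases h0 : ω = 0
  · right
    rw [h0, ampFactor_zero hk, ampFactor_zero hk, one_pow]
  · exact Or.inl (norm_ampFactor_lt_one hk hmc hω.1 h0)

theorem finite_spatialFreqs (nx : ℕ) [NeZero nx] : (spatialFreqs nx).Finite := by
  have hn : (0 : ℝ) < nx := by exact_mod_cast NeZero.pos nx
  refine ((Set.finite_Icc (-(nx : ℤ)) nx).image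
    (fun k : ℤ => 2 * Real.pi * k / nx)).subset ?_
  rintro ω ⟨⟨h1, h2⟩, l, rfl⟩
  refine ⟨l, ?_, rfl⟩
  have hpi := Real.pi_pos
  rw [le_div_iff₀ hn] at h1
  rw [div_lt_iff₀ hn] at h2
  have h3 : (l : ℝ) ≤ nx := by nlinarith
  have h4 : -(nx : ℝ) ≤ l := by nlinarith
  exact ⟨by exact_mod_cast h4, by exact_mod_cast h3⟩

theorem zero_mem_spatialFreqs (nx : ℕ) : (0 : ℝ) ∈ spatialFreqs nx :=
  ⟨⟨by linarith [Real.pi_pos], Real.pi_pos⟩, 0, by simp⟩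

theorem exists_thetaLow_eq {β : Type*} {m : ℕ} (hm : 1 ≤ m) {F : ℝ → β}
    (hF : Function.Periodic F (2 * Real.pi / m)) (x : ℝ) : ∃ θ ∈ thetaLow m, F x = F θ := by
  have hm0 : (0 : ℝ) < m := by exact_mod_cast hm
  obtain ⟨y, hy, h⟩ := hF.exists_mem_Ico (by have := Real.pi_pos; positivity) x (-(Real.pi / m))
  refine ⟨y, ?_, h⟩
  have e : -(Real.pi / m) + 2 * Real.pi / m = Real.pi / m := by ring
  rwa [e] at hy

theorem periodic_exp_mul {m : ℕ} (hm : 1 ≤ m) :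
    Function.Periodic (fun θ : ℝ => Complex.exp (Complex.I * (m * θ : ℝ))) (2 * Real.pi / m) := by
  intro θ
  have hm0 : (m : ℂ) ≠ 0 := by exact_mod_cast (by omega : m ≠ 0)
  simp only
  rw [Complex.exp_eq_exp_iff_exists_int]
  refine ⟨1, ?_⟩
  push_cast
  field_simp

/-- The half-open interval is not compact, so the maximum is taken on its closure and moved back by
periodicity. The case A = 0 serves ω = 0, where the denominator vanishes at θ = 0 but the quotient
is identically 0. -/
theorem exists_thetaLow_max {m : ℕ} (hm : 1 ≤ m) (A : ℝ) {μ : ℂ} (h : ‖μ‖ < 1 ∨ A = 0) :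
    ∃ θ ∈ thetaLow m, ∀ θ', A / ‖Complex.exp (Complex.I * (m * θ' : ℝ)) - μ‖ ≤
      A / ‖Complex.exp (Complex.I * (m * θ : ℝ)) - μ‖ := by
  set F : ℝ → ℝ := fun θ => A / ‖Complex.exp (Complex.I * (m * θ : ℝ)) - μ‖ with hF
  have hper : Function.Periodic F (2 * Real.pi / m) :=
    (periodic_exp_mul hm).comp (fun z => A / ‖z - μ‖)
  have hcont : Continuous F := by
    rcases h with h | h
    · refine Continuous.div continuous_const (by fun_prop) fun θ h0 => ?_
      rw [norm_eq_zero, sub_eq_zero] at h0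
      rw [← h0, norm_exp_I_mul] at h
      exact lt_irrefl _ h
    · simp only [hF, h, zero_div]
      exact continuous_const
  have hpi := Real.pi_pos
  obtain ⟨x, -, hx⟩ := (isCompact_Icc (a := -(Real.pi / m)) (b := Real.pi / m)).exists_isMaxOn
    (Set.nonempty_Icc.2 (by have : 0 ≤ Real.pi / m := by positivity
                            linarith)) hcont.continuousOn
  obtain ⟨θ, hθ, hxθ⟩ := exists_thetaLow_eq hm hper x
  refine ⟨θ, hθ, fun θ' => ?_⟩
  obtain ⟨y, hy, hy'⟩ := exists_thetaLow_eq hm hper θ'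
  change F θ' ≤ F θ
  rw [hy', ← hxθ]
  exact hx (Set.Ico_subset_Icc_self hy)

theorem exists_isGreatest_lfaSpectralRadius {p nx k m : ℕ} [NeZero nx] (hpk : p + 1 = 2 * k)
    (hm : 1 ≤ m) (ν : ℕ) {α δt c : ℝ} (hc : α * δt / meshWidth nx = c)
    (hmc : Int.fract (m * c) ≠ 0) :
    ∃ M : ℝ, IsGreatest {ρ : ℝ | ∃ ω ∈ spatialFreqs nx, ∃ θ ∈ thetaLow m,
      ρ = lfaSpectralRadius nx m ν (semiLagrangian p nx α δt)
        (semiLagrangian p nx α (m * δt)) ω θ} M := by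
  have hk : 1 ≤ k := by omega
  set ρ := lfaSpectralRadius nx m ν (semiLagrangian p nx α δt) (semiLagrangian p nx α (m * δt))
    with hρ
  have hmax : ∀ ω ∈ spatialFreqs nx, ∃ θ ∈ thetaLow m, ∀ θ', ρ ω θ' ≤ ρ ω θ := by
    intro ω hω
    simp only [hρ, lfaSpectralRadius_semiLagrangian hpk hm ν hc hmc hω]
    refine exists_thetaLow_max hm _ ?_
    by_cases h0 : ω = 0
    · right
      rw [h0, ampFactor_zero hk, ampFactor_zero hk]
      simp
    · exact Or.inl (norm_ampFactor_lt_one hk hmc hω.1 h0)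
  choose! t ht htmax using hmax
  obtain ⟨ω, hω, hωmax⟩ := Set.exists_max_image _ (fun ω => ρ ω (t ω)) (finite_spatialFreqs nx)
    ⟨0, zero_mem_spatialFreqs nx⟩
  refine ⟨ρ ω (t ω), ⟨ω, hω, t ω, ht ω hω, rfl⟩, ?_⟩
  rintro _ ⟨ω', hω', θ', -, rfl⟩
  exact (htmax ω' hω' θ').trans (hωmax ω' hω')

/-- The convergence factor at the lowest nonzero spatial frequency and the temporal frequency of
the advected mode. -/
theorem exists_lfaSpectralRadius_eq {p nx k m : ℕ} [NeZero nx] (hpk : p + 1 = 2 * k)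
    (hm : 1 ≤ m) (ν : ℕ) {α δt c : ℝ} (hc : α * δt / meshWidth nx = c)
    (hmc : Int.fract (m * c) ≠ 0) (hnx : 3 ≤ nx) :
    ∃ ω ∈ spatialFreqs nx, ∃ θ ∈ thetaLow m,
      lfaSpectralRadius nx m ν (semiLagrangian p nx α δt) (semiLagrangian p nx α (m * δt)) ω θ =
        ‖relFactor k (1 - 2 * Int.fract c) (Real.pi / nx) ^ m -
          relFactor k (1 - 2 * Int.fract (m * c)) (Real.pi / nx)‖ *
        ‖relFactor k (1 - 2 * Int.fract c) (Real.pi / nx)‖ ^ (m * ν) /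
        ‖1 - relFactor k (1 - 2 * Int.fract (m * c)) (Real.pi / nx)‖ := by
  have hn : (3 : ℝ) ≤ nx := by exact_mod_cast hnx
  have hpi := Real.pi_pos
  set ω : ℝ := 2 * Real.pi / nx with hω
  have hωmem : ω ∈ spatialFreqs nx := by
    refine ⟨⟨?_, ?_⟩, 1, by simp [hω]⟩
    · have : 0 < ω := by positivity
      linarith
    · rw [hω, div_lt_iff₀ (by linarith)]
      nlinarith
  -- With θ = −ωc modulo 2π/m, the numbers exp(imθ), λ^m and μ share the phase e, which drops out of
  -- the norms.
  obtain ⟨θ, hθ, h⟩ := exists_thetaLow_eq hm (periodic_exp_mul hm) (-(ω * c))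
  refine ⟨ω, hωmem, θ, hθ, ?_⟩
  set e := Complex.exp (Complex.I * ((m * -(ω * c) : ℝ) : ℂ)) with he
  have hen : ‖e‖ = 1 := norm_exp_I_mul _
  have hφ : ω / 2 = Real.pi / nx := by rw [hω]; ring
  have h1 : ampFactor k c ω ^ m = e * relFactor k (1 - 2 * Int.fract c) (Real.pi / nx) ^ m := by
    rw [ampFactor, mul_pow, hφ, ← Complex.exp_nat_mul, he]
    congr 2
    push_cast
    ring
  have h2 : ampFactor k (m * c) ω =
      e * relFactor k (1 - 2 * Int.fract (m * c)) (Real.pi / nx) := by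
    rw [ampFactor, hφ, he]
    congr 4
    ring
  have h3 : ‖ampFactor k c ω‖ = ‖relFactor k (1 - 2 * Int.fract c) (Real.pi / nx)‖ := by
    rw [ampFactor, norm_mul, norm_exp_I_mul, one_mul, hφ]
  rw [lfaSpectralRadius_semiLagrangian hpk hm ν hc hmc hωmem, ← h, h1, h2, h3, ← mul_sub,
    ← mul_one_sub, norm_mul, norm_mul, hen, one_mul, one_mul]

theorem rhoCheck_fract {p k : ℕ} (hpk : p + 1 = 2 * k) (m : ℕ) (c : ℝ) :
    rhoCheck p m (Int.fract c) = m * (defect k (1 - 2 * Int.fract c) /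
      defect k (1 - 2 * Int.fract (m * c))) - 1 := by
  have hk : (k : ℝ) ≠ 0 := by exact_mod_cast (by omega : k ≠ 0)
  have hf : ((2 * k).factorial : ℝ) ≠ 0 := by exact_mod_cast Nat.factorial_ne_zero _
  have hfr : Int.fract ((m : ℝ) * Int.fract c) = Int.fract (m * c) := by
    have : (m : ℝ) * Int.fract c = m * c - ((m * ⌊c⌋ : ℤ) : ℝ) := by
      rw [Int.fract]
      push_cast
      ring
    rw [this, Int.fract_sub_intCast]
  have hd : ∀ ε : ℝ, defect k (1 - 2 * ε) =
      2 * k * 4 ^ k / (2 * k).factorial * nodeProd k (ε * (1 - ε)) := by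
    intro ε
    rw [div_mul_eq_mul_div, eq_div_iff hf]
    exact defect_eq_prod k ε
  rw [rhoCheck_eq hpk, hfr, hd, hd, mul_div_mul_left]
  positivity

end Maximum
end MGRIT
end

theorem theorem6p2 (p : ℕ) (hp : Odd p) (m : ℕ) (hm : 1 ≤ m) :
    -- the lower bound on the maximal spectral radius, at a fixed CFL number `c`
    (∀ c : ℝ, 0 < c → c - ⌊c⌋ ∈ MGRIT.Upsilon m →
      ∃ C : ℝ, ∀ ν : ℕ, ∃ g : ℕ → ℝ, IsBigOWith C atTop g MGRIT.meshWidth ∧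
        ∀ (nx : ℕ) [NeZero nx] (α δt : ℝ), 0 < α → 0 < δt → α * δt / MGRIT.meshWidth nx = c →
          ∃ M : ℝ,
            IsGreatest
              {ρ : ℝ | ∃ ω ∈ MGRIT.spatialFreqs nx, ∃ θ ∈ MGRIT.thetaLow m,
                ρ = MGRIT.lfaSpectralRadius nx m ν (MGRIT.semiLagrangian p nx α δt)
                  (MGRIT.semiLagrangian p nx α (m * δt)) ω θ} M ∧
            MGRIT.rhoCheck p m (c - ⌊c⌋) * (1 + g nx) ≤ M) ∧
    -- the interval on which the lower bound exceeds one
    (2 ≤ m → ∀ ε ∈ MGRIT.Upsilon m ∩ Set.Ioo (2 / (3 * (m : ℝ))) (1 - 2 / (3 * (m : ℝ))),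
      1 < MGRIT.rhoCheck p m ε) := by
  obtain ⟨n, hn⟩ := hp
  have hpk : p + 1 = 2 * (n + 1) := by omega
  refine ⟨fun c _ hc => ?_, fun hm2 ε hε => MGRIT.one_lt_rhoCheck hpk hm2 hε.1 hε.2.1 hε.2.2⟩
  set k := n + 1 with hk
  have hk1 : 1 ≤ k := by omega
  change Int.fract c ∈ _ at hc
  change ∃ C : ℝ, ∀ ν : ℕ, ∃ g : ℕ → ℝ, IsBigOWith C atTop g MGRIT.meshWidth ∧
    ∀ (nx : ℕ) [NeZero nx] (α δt : ℝ), 0 < α → 0 < δt → α * δt / MGRIT.meshWidth nx = c →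
      ∃ M : ℝ, IsGreatest _ M ∧ MGRIT.rhoCheck p m (Int.fract c) * (1 + g nx) ≤ M
  have hfc : Int.fract c ≠ 0 := hc.1.1.ne'
  have hmc : Int.fract ((m : ℝ) * c) ≠ 0 := by
    have h : Int.fract ((m : ℝ) * Int.fract c) ≠ 0 := hc.2
    have e : (m : ℝ) * Int.fract c = m * c - ((m * ⌊c⌋ : ℤ) : ℝ) := by
      rw [Int.fract]
      push_cast
      ring
    rwa [e, Int.fract_sub_intCast] at h
  have hM0 : ∀ (nx : ℕ) [NeZero nx] (ν : ℕ) (α δt M : ℝ),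
      IsGreatest {ρ : ℝ | ∃ ω ∈ MGRIT.spatialFreqs nx, ∃ θ ∈ MGRIT.thetaLow m,
        ρ = MGRIT.lfaSpectralRadius nx m ν (MGRIT.semiLagrangian p nx α δt)
          (MGRIT.semiLagrangian p nx α (m * δt)) ω θ} M → 0 ≤ M := by
    rintro nx _ ν α δt M ⟨⟨ω, _, θ, _, rfl⟩, _⟩
    exact ENNReal.toReal_nonneg
  -- A nonpositive bound holds trivially, as spectral radii are nonnegative.
  rcases le_or_gt (MGRIT.rhoCheck p m (Int.fract c)) 0 with hr | hr
  · refine ⟨0, fun ν => ⟨fun _ => 0, ?_, fun nx _ α δt _ _ hcfl => ?_⟩⟩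
    · simp [isBigOWith_iff]
    · obtain ⟨M, hM⟩ := MGRIT.exists_isGreatest_lfaSpectralRadius hpk hm ν hcfl hmc
      refine ⟨M, hM, ?_⟩
      have := hM0 nx ν α δt M hM
      linarith
  · obtain ⟨C, hC⟩ := MGRIT.exists_lower_bound hk1 m
      (MGRIT.one_sub_two_mul_fract_sq_lt_one hfc) (MGRIT.one_sub_two_mul_fract_sq_lt_one hmc)
      (MGRIT.rhoCheck_fract hpk m c) hr
    refine ⟨|C| * (Real.pi / 2), fun ν => ?_⟩
    obtain ⟨φ₀, hφ₀, hφ⟩ := hC ν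
    classical
    -- On coarse meshes the value −1 makes the bound 0; only finitely many nx are affected,
    -- depending on ν. The factor π/2 above comes from φ = π/nx = (π/2)h.
    refine ⟨fun nx => if 3 ≤ nx ∧ Real.pi / nx ≤ φ₀ then -(C * (Real.pi / nx)) else -1, ?_,
      fun nx _ α δt _ _ hcfl => ?_⟩
    · rw [isBigOWith_iff]
      filter_upwards [eventually_ge_atTop 3,
        (tendsto_const_div_atTop_nhds_zero_nat Real.pi).eventually_le_const hφ₀] with nx h1 h2
      rw [if_pos ⟨h1, h2⟩, norm_neg, norm_mul, Real.norm_eq_abs,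
        Real.norm_of_nonneg (by positivity), MGRIT.meshWidth, Real.norm_of_nonneg (by positivity)]
      exact le_of_eq (by ring)
    · obtain ⟨M, hM⟩ := MGRIT.exists_isGreatest_lfaSpectralRadius hpk hm ν hcfl hmc
      refine ⟨M, hM, ?_⟩
      simp only
      split_ifs with h
      · obtain ⟨ω, hω, θ, hθ, hρ⟩ := MGRIT.exists_lfaSpectralRadius_eq hpk hm ν hcfl hmc h.1
        have hn0 : (0 : ℝ) < nx := by exact_mod_cast NeZero.pos nx
        have h1 := hφ (Real.pi / nx) (div_pos Real.pi_pos hn0) h.2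
        rw [← hρ] at h1
        rw [← sub_eq_add_neg]
        exact h1.trans (hM.2 ⟨ω, hω, θ, hθ, rfl⟩)
      · have := hM0 nx ν α δt M hM
        linarith
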